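/- Definitions. Let $\mathcal L$ be the family of slowly varying functions $\ell:[x_0,\infty)\to(0,\infty)$ ($x_0=x_0(\ell)>0$) of the form $\ell(x)=\exp\big(\int_{x_0}^x\frac{\vartheta(t)}{t}\,dt\big)$, where $\vartheta\in C^2([x_0,\infty))$ is real and $\vartheta(x)\to0$, $x\vartheta'(x)\to0$, $x^2\vartheta''(x)\to0$ as $x\to\infty$. Let $\mathcal L_0$ be the family of slowly varying $\ell$ of the same form for which $\vartheta\in C^2([x_0,\infty))$ is positive and decreasing, $\vartheta(x)\to0$, $x\vartheta'(x)/\vartheta(x)\to0$, $x^2\vartheta''(x)/\vartheta(x)\to0$ as $x\to\infty$, for every $\varepsilon>0$ there is $C_\varepsilon>0$ with $1\le C_\varepsilon\vartheta(x)x^{\varepsilon}$ for all $x\ge x_0$, and $\ell(x)\to\infty$. For $c\in(0,2)$ let $\mathcal R_c$ be the family of (strictly) increasing convex functions $h:[x_0,\infty)\to[1,\infty)$ of the form $h(x)=x^cL(x)$ on $[x_0,\infty)$, where $L:[x_0,\infty)\to(0,\infty)$ belongs to $\mathcal L$ if $c\ne1$ and to $\mathcal L_0$ if $c=1$. Let $c_1\in[1,2)$,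 $c_2\in[1,6/5)$, $h_1\in\mathcal R_{c_1}$, $h_2\in\mathcal R_{c_2}$, and let $\varphi_1,\varphi_2$ be the inverse functions of $h_1,h_2$. Let $\psi:[x_0,\infty)\to(0,1/2]$ satisfy $$\lim_{x\to\infty}\frac{\psi(x)}{\varphi_2'(x)}=\lim_{x\to\infty}\frac{\psi'(x)}{\varphi_2''(x)}=\lim_{x\to\infty}\frac{\psi''(x)}{\varphi_2'''(x)}=1 .$$ (The left end points of the domains of $h_1$, $h_2$ and $\psi$ need not coincide.) Let $\mathbf B$ be either of the sets $$\mathbf B_{+}=\{n\in\mathbb N:\{\varphi_1(n)\}<\psi(n)\},\qquad \mathbf B_-=\{n\in\mathbb N:\{-\varphi_1(n)\}<\psi(n)\},$$ where $\mathbb N=\{1,2,\dots\}$, $\{x\}$ is the fractional part of $x$, and only those $n$ are considered at which $\varphi_1$ and $\psi$ are both defined. For $N\in\mathbb N$ put $\mathbf B_N=\mathbf B\cap[1,N]$ and $$\mu_N=N^{-1}\sum_{n\in\mathbf B_N}\psi(n)^{-1}\delta_n,\qquad T_Nf(\xi)=\mathcal F(f\mu_N)(\xi)=\sum_{n\in\mathbb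 Z}f(n)\mu_N(n)e^{2\pi i n\xi}\quad(\xi\in\mathbb T=\mathbb R/\mathbb Z).$$ Proposition. For each real $p>2$ with $$p\ \ge\ 2+\frac{12-12/c_2}{1/c_1+3/c_2-3}$$ there is a constant $C_p>0$ such that for all $N\in\mathbb N$ and all $f\in L^2(\mathbf B_N,\mu_N)$ $$\|T_Nf\|_{L^p(\mathbb T)}\le C_pN^{-1/p}\|f\|_{L^2(\mathbf B_N,\mu_N)} .$$ -/

import Mathlib

open MeasureTheory Filter Topology
open scoped ENNReal

noncomputable section

namespace Majorant

/-- `ℓ` is slowly varying at infinity. -/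
def IsSlowlyVarying (ℓ : ℝ → ℝ) : Prop :=
  ∀ a : ℝ, 0 < a → Tendsto (fun x => ℓ (a * x) / ℓ x) atTop (𝓝 1)

/-- The family `𝓛` of slowly varying functions `ℓ : [x₀, ∞) → (0, ∞)` of the form
`ℓ x = exp (∫_{x₀}^x ϑ(t)/t dt)`. Only the values of `ℓ` and `ϑ` on `[x₀, ∞)` matter. -/
def ClassL (x₀ : ℝ) (ℓ : ℝ → ℝ) : Prop :=
  0 < x₀ ∧ IsSlowlyVarying ℓ ∧
  ∃ ϑ : ℝ → ℝ, ContDiffOn ℝ 2 ϑ (Set.Ici x₀) ∧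
    (∀ x, x₀ ≤ x → ℓ x = Real.exp (∫ t in x₀..x, ϑ t / t)) ∧
    Tendsto ϑ atTop (𝓝 0) ∧
    Tendsto (fun x => x * deriv ϑ x) atTop (𝓝 0) ∧
    Tendsto (fun x => x ^ 2 * deriv (deriv ϑ) x) atTop (𝓝 0)

/-- The subfamily `𝓛₀`, in which `ϑ` is moreover positive, decreasing and decays slower than
any negative power, and `ℓ` tends to infinity. -/
def ClassL0 (x₀ : ℝ) (ℓ : ℝ → ℝ) : Prop :=
  0 < x₀ ∧ IsSlowlyVarying ℓ ∧
  (∃ ϑ : ℝ → ℝ, ContDiffOn ℝ 2 ϑ (Set.Ici x₀) ∧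
    (∀ x, x₀ ≤ x → ℓ x = Real.exp (∫ t in x₀..x, ϑ t / t)) ∧
    (∀ x, x₀ ≤ x → 0 < ϑ x) ∧ AntitoneOn ϑ (Set.Ici x₀) ∧
    Tendsto ϑ atTop (𝓝 0) ∧
    Tendsto (fun x => x * deriv ϑ x / ϑ x) atTop (𝓝 0) ∧
    Tendsto (fun x => x ^ 2 * deriv (deriv ϑ) x / ϑ x) atTop (𝓝 0) ∧
    (∀ ε : ℝ, 0 < ε → ∃ C : ℝ, 0 < C ∧ ∀ x, x₀ ≤ x → 1 ≤ C * ϑ x * x ^ ε)) ∧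
  Tendsto ℓ atTop atTop

/-- The family `𝓡_c` of increasing, convex functions `h : [x₀, ∞) → [1, ∞)` of the form
`h x = x ^ c * L x` with `L ∈ 𝓛`, and `L ∈ 𝓛₀` in the case `c = 1`. -/
def ClassR (c x₀ : ℝ) (h : ℝ → ℝ) : Prop :=
  c ∈ Set.Ioo (0 : ℝ) 2 ∧
  (∀ x, x₀ ≤ x → 1 ≤ h x) ∧
  StrictMonoOn h (Set.Ici x₀) ∧
  ConvexOn ℝ (Set.Ici x₀) h ∧
  ∃ L : ℝ → ℝ, (c ≠ 1 → ClassL x₀ L) ∧ (c = 1 → ClassL0 x₀ L) ∧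
    ∀ x, x₀ ≤ x → h x = x ^ c * L x

/-- The inverse function `φ : [h x₀, ∞) → [x₀, ∞)` of `h : [x₀, ∞) → [h x₀, ∞)`
(junk values below `h x₀`). -/
def inverse (x₀ : ℝ) (h : ℝ → ℝ) : ℝ → ℝ :=
  Function.invFunOn h (Set.Ici x₀)

/-- The assumptions on `ψ : [x₀, ∞) → (0, 1/2]` relative to `φ`: the quotients `ψ/φ'`,
`ψ'/φ''`, `ψ''/φ'''` tend to `1`. As `deriv` is `0` at points of non-differentiability and
`a / 0 = 0`, these limits force `ψ` to be twice, and `φ` three times, differentiable at all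
large `x`, with `φ'`, `φ''`, `φ'''` nonzero there. -/
def AdmissibleWeight (φ : ℝ → ℝ) (x₀ : ℝ) (ψ : ℝ → ℝ) : Prop :=
  (∀ x, x₀ ≤ x → 0 < ψ x ∧ ψ x ≤ 1 / 2) ∧
  Tendsto (fun x => ψ x / deriv φ x) atTop (𝓝 1) ∧
  Tendsto (fun x => deriv ψ x / deriv (deriv φ) x) atTop (𝓝 1) ∧
  Tendsto (fun x => deriv (deriv ψ) x / deriv (deriv (deriv φ)) x) atTop (𝓝 1)

/-- The set `𝐁_s = {n : {s φ₁(n)} < ψ(n)}`, for a sign `s = ±1`, where `φ₁` is the inverse of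
`h₁ : [x₁, ∞) → [h₁ x₁, ∞)` and `ψ` lives on `[x₃, ∞)`; `n` runs over the positive integers
at which both `φ₁` and `ψ` are defined. -/
def setB (s : ℤˣ) (x₁ : ℝ) (h₁ : ℝ → ℝ) (x₃ : ℝ) (ψ : ℝ → ℝ) : Set ℕ :=
  {n | 1 ≤ n ∧ h₁ x₁ ≤ (n : ℝ) ∧ x₃ ≤ (n : ℝ) ∧
    Int.fract (((s : ℤ) : ℝ) * inverse x₁ h₁ (n : ℝ)) < ψ (n : ℝ)}

open Classical in
/-- The measure `μ_N = N⁻¹ ∑_{n ∈ B ∩ [1, N]} ψ(n)⁻¹ δ_n` on `ℤ`. -/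
def muN (B : Set ℕ) (ψ : ℝ → ℝ) (N : ℕ) : Measure ℤ :=
  (N : ℝ≥0∞)⁻¹ • ∑ n ∈ (Finset.Icc 1 N).filter (fun n => n ∈ B),
    ENNReal.ofReal ((ψ (n : ℝ))⁻¹) • Measure.dirac (n : ℤ)

/-- The Fourier transform on `ℤ`: `𝓕 g (ξ) = ∑_{n ∈ ℤ} g(n) e^{2πinξ}`, for `ξ ∈ ℝ/ℤ`. -/
def fourierZ (g : ℤ → ℂ) (ξ : UnitAddCircle) : ℂ :=
  ∑' n : ℤ, g n * fourier n ξ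

/-- The operator `T_N f = 𝓕 (f μ_N)`. -/
def opT (B : Set ℕ) (ψ : ℝ → ℝ) (N : ℕ) (f : ℤ → ℂ) : UnitAddCircle → ℂ :=
  fourierZ (fun n => f n * ((muN B ψ N).real {n} : ℂ))

end Majorant

end

namespace Majorant

/-! The measure `μ_N` is compared with the uniform measure on `{1, …, N}`, and a Tomas–Stein
argument is run on the difference. Write `g_i = 1/c_i`. Two facts about the difference enter: its
point masses are at most `D ≲ N^(-g₂ + ε')`, because `ψ(n)` has size about `n^(g₂ - 1)`, and its
Fourier transform is at most `E ≲ N^(-χ)`, uniformly in the frequency.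

Restriction. For `g` of modulus one on a set `A` of measure `a` and zero elsewhere, the uniform part
of `∑ μ_N(n) |ĝ(n)|²` is at most `min(a/N, a²)` (Bessel, and the trivial bound for `ĝ`); the
difference contributes at most `min(D a, E a²)`. The geometric means with weight `θ = 2/q` are `≲
N^(-θ) a^(2-θ)` as soon as `D^θ E^(1-θ) ≲ N^(-θ)`. By duality this is a weak type `(2, q)` bound for
the level sets of `T_N f` (`volume_level_le`). The trivial sup bound upgrades it to strong type for
every `p > q` (`lintegral_rpow_le_of_level`, `eLpNorm_trigPoly_le`).

Decay of the Fourier transform. The indicator of `{x} < u`, minus `u`, is a difference of two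
sawtooth values. The sawtooth is replaced by its mean over an interval of length `δ`, whose Fourier
series converges absolutely, so only sums of `e(m t_n + nξ)` are needed. These are treated by van
der Corput's second derivative test, uniformly in `ξ` since a linear phase has no second difference.
The moving threshold `ψ(n)` is frozen on short blocks (`norm_sum_weight_le`). The outcome is
`exists_norm_sum_weight_sub_one_le`, for every `χ` with `2χ < min(2g₂ - 1 - g₁/2, g₁/2 + g₂ - 1)`.

Exponents. The stated threshold for `p` corresponds to `χ₀ = (g₁ + 3g₂ - 3)/6`, and `2χ₀` lies
strictly below that minimum because `g₁ > 0` and `g₂ > 5/6 ≥ 5g₁/6`. This slack pays for all `ε`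
losses and allows some `q < p` even at the endpoint (`exists_exponents`). -/

/-! ### Exponential sums: the Kusmin–Landau inequality. -/

/-- The additive character `x ↦ e^{2πix}`. -/
noncomputable def expi (x : ℝ) : ℂ := Complex.exp (((2 * Real.pi * x : ℝ) : ℂ) * Complex.I)

lemma expi_add (x y : ℝ) : expi (x + y) = expi x * expi y := by
  rw [expi, expi, expi, ← Complex.exp_add]; congr 1; push_cast; ring

lemma norm_expi (x : ℝ) : ‖expi x‖ = 1 := Complex.norm_exp_ofReal_mul_I _

lemma expi_zero : expi 0 = 1 := by simp [expi]

lemma expi_neg (x : ℝ) : expi (-x) = (starRingEnd ℂ) (expi x) := by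
  rw [expi, expi, ← Complex.exp_conj, map_mul, Complex.conj_ofReal, Complex.conj_I]
  congr 1
  push_cast; ring

lemma expi_int (k : ℤ) : expi k = 1 := by
  rw [expi, Complex.exp_eq_one_iff]
  exact ⟨k, by push_cast; ring⟩

lemma expi_eq_cos_sin (x : ℝ) :
    expi x = (Real.cos (2 * Real.pi * x) : ℂ) + (Real.sin (2 * Real.pi * x) : ℂ) * Complex.I := by
  rw [expi, Complex.exp_mul_I]; push_cast; rfl

lemma expi_re (x : ℝ) : (expi x).re = Real.cos (2 * Real.pi * x) := by
  rw [expi, Complex.exp_ofReal_mul_I_re]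

lemma norm_expi_sub_one_le_two (x : ℝ) : ‖expi x - 1‖ ≤ 2 := by
  refine (norm_sub_le _ _).trans ?_
  rw [norm_expi]; norm_num

lemma norm_expi_sub_one_le (x : ℝ) : ‖expi x - 1‖ ≤ 2 * Real.pi * |x| := by
  have h := Real.norm_exp_I_mul_ofReal_sub_one_le (x := 2 * Real.pi * x)
  rw [mul_comm, Real.norm_eq_abs, abs_mul, abs_of_pos Real.two_pi_pos] at h
  exact h

lemma norm_sum_expi_le (s : Finset ℕ) (f : ℕ → ℝ) : ‖∑ n ∈ s, expi (f n)‖ ≤ s.card := by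
  refine (norm_sum_le _ _).trans ?_
  simp [norm_expi]

/-- The cotangent of `πx`. -/
noncomputable def cotPi (x : ℝ) : ℝ := Real.cos (Real.pi * x) / Real.sin (Real.pi * x)

lemma sin_pi_mul_pos {x : ℝ} (h0 : 0 < x) (h1 : x < 1) : 0 < Real.sin (Real.pi * x) :=
  Real.sin_pos_of_pos_of_lt_pi (by positivity) (by nlinarith [Real.pi_pos])

lemma two_mul_le_sin_pi_mul {x θ : ℝ} (h : 0 < θ) (h0 : θ ≤ x) (h1 : x ≤ 1 - θ) :
    2 * θ ≤ Real.sin (Real.pi * x) := by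
  have hp := Real.pi_pos
  rcases le_total x (1 / 2) with hx | hx
  · have := Real.mul_le_sin (x := Real.pi * x) (by nlinarith) (by nlinarith)
    have h2 : 2 / Real.pi * (Real.pi * x) = 2 * x := by field_simp
    linarith
  · have := Real.mul_le_sin (x := Real.pi - Real.pi * x) (by nlinarith) (by nlinarith)
    have h2 : 2 / Real.pi * (Real.pi - Real.pi * x) = 2 * (1 - x) := by field_simp
    rw [Real.sin_pi_sub] at this
    linarith

lemma abs_cotPi_le {x θ : ℝ} (h : 0 < θ) (h0 : θ ≤ x) (h1 : x ≤ 1 - θ) :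
    |cotPi x| ≤ 1 / (2 * θ) := by
  have h2 := two_mul_le_sin_pi_mul h h0 h1
  rw [cotPi, abs_div, abs_of_pos (by linarith : 0 < Real.sin (Real.pi * x))]
  exact div_le_div₀ zero_le_one (Real.abs_cos_le_one _) (by positivity) h2

lemma cotPi_anti {x y : ℝ} (h0 : 0 < x) (hxy : x ≤ y) (h1 : y < 1) : cotPi y ≤ cotPi x := by
  have hx := sin_pi_mul_pos h0 (hxy.trans_lt h1)
  have hy := sin_pi_mul_pos (h0.trans_le hxy) h1
  rw [cotPi, cotPi, div_le_div_iff₀ hy hx, ← sub_nonneg]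
  have h2 : 0 ≤ Real.sin (Real.pi * y - Real.pi * x) :=
    Real.sin_nonneg_of_nonneg_of_le_pi (by nlinarith [Real.pi_pos]) (by nlinarith [Real.pi_pos])
  rw [Real.sin_sub] at h2
  linarith

/-- The complex number `(1 - e^{2πix})⁻¹`, written through the cotangent. -/
noncomputable def halfCot (x : ℝ) : ℂ := 1 / 2 + (cotPi x : ℂ) / 2 * Complex.I

lemma halfCot_mul {x : ℝ} (h0 : 0 < x) (h1 : x < 1) : halfCot x * (1 - expi x) = 1 := by
  have hs := (sin_pi_mul_pos h0 h1).ne'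
  have e : 2 * Real.pi * x = 2 * (Real.pi * x) := by ring
  have hsc := Real.sin_sq_add_cos_sq (Real.pi * x)
  rw [halfCot, expi_eq_cos_sin, cotPi, e, Real.cos_two_mul, Real.sin_two_mul]
  set S := Real.sin (Real.pi * x)
  set K := Real.cos (Real.pi * x)
  have hK : (K : ℂ) ^ 2 = 1 - (S : ℂ) ^ 2 := by
    rw [eq_sub_iff_add_eq]; norm_cast; linarith
  have hS : (S : ℂ) ≠ 0 := by exact_mod_cast hs
  push_cast
  field_simp
  ring_nf
  simp only [Complex.I_sq]
  rw [show (K : ℂ) ^ 3 = K * K ^ 2 by ring, hK]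
  ring

lemma norm_halfCot_le {x θ : ℝ} (h : 0 < θ) (h0 : θ ≤ x) (h1 : x ≤ 1 - θ) :
    ‖halfCot x‖ ≤ 1 / (2 * θ) := by
  have h2 := abs_cotPi_le h h0 h1
  refine (norm_add_le _ _).trans ?_
  rw [norm_mul, Complex.norm_I, mul_one, norm_div, norm_div, Complex.norm_real, Real.norm_eq_abs]
  simp only [norm_one, Complex.norm_ofNat]
  have h3 : 1 ≤ 1 / (2 * θ) := by rw [le_div_iff₀ (by positivity)]; linarith
  linarith

/-- The real part of `halfCot` is constant, so its variation is that of the monotone cotangent. This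
is what makes the total variation telescope in the partial summation. -/
lemma norm_halfCot_sub {x y : ℝ} (h0 : 0 < x) (hxy : x ≤ y) (h1 : y < 1) :
    ‖halfCot y - halfCot x‖ = (cotPi x - cotPi y) / 2 := by
  have h2 := cotPi_anti h0 hxy h1
  have : halfCot y - halfCot x = (((cotPi y - cotPi x) / 2 : ℝ) : ℂ) * Complex.I := by
    rw [halfCot, halfCot]; push_cast; ring
  rw [this, norm_mul, Complex.norm_I, mul_one, Complex.norm_real, Real.norm_eq_abs,
    abs_of_nonpos (by linarith)]
  ring

/-- Partial summation based on `e(f n) = halfCot(Δ_n) (e(f n) - e(f (n+1)))`, where `Δ_n = f (n+1) -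
f n`. The boundary term stays on the left so that the induction closes; each step then costs
`‖halfCot Δ_{n+1} - halfCot Δ_n‖`, and these costs telescope. -/
lemma norm_sum_expi_add_halfCot_le (f : ℕ → ℝ) (a : ℕ) {θ : ℝ} (hθ : 0 < θ) (k : ℕ)
    (hd : ∀ n, a ≤ n → n ≤ a + k → θ ≤ f (n + 1) - f n ∧ f (n + 1) - f n ≤ 1 - θ)
    (hm : ∀ n, a ≤ n → n < a + k → f (n + 1) - f n ≤ f (n + 2) - f (n + 1)) :
    ‖∑ n ∈ Finset.Ico a (a + k + 1), expi (f n)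
        + halfCot (f (a + k + 1) - f (a + k)) * expi (f (a + k + 1))‖
      ≤ 1 / (2 * θ) + (cotPi (f (a + 1) - f a) - cotPi (f (a + k + 1) - f (a + k))) / 2 := by
  have key : ∀ n, a ≤ n → n ≤ a + k →
      expi (f n) + halfCot (f (n + 1) - f n) * expi (f (n + 1))
        = halfCot (f (n + 1) - f n) * expi (f n) := by
    intro n h1 h2
    obtain ⟨h3, h4⟩ := hd n h1 h2
    have h5 := halfCot_mul (hθ.trans_le h3) (by linarith)
    have h6 : expi (f (n + 1)) = expi (f n) * expi (f (n + 1) - f n) := by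
      rw [← expi_add]; congr 1; ring
    rw [h6]
    linear_combination (-expi (f n)) * h5
  induction k with
  | zero =>
    have h1 := hd a le_rfl le_rfl
    simp only [Nat.add_zero, Nat.Ico_succ_singleton, Finset.sum_singleton]
    rw [key a le_rfl le_rfl, norm_mul, norm_expi]
    have := norm_halfCot_le hθ h1.1 h1.2
    simpa using this
  | succ k ih =>
    have ih' := ih (fun n h1 h2 => hd n h1 (by omega)) (fun n h1 h2 => hm n h1 (by omega))
      (fun n h1 h2 => key n h1 (by omega))
    have hk := key (a + k + 1) (by omega) (by omega)
    have h1 := hd (a + k) (by omega) (by omega)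
    have h2 := hd (a + k + 1) (by omega) (by omega)
    have h3 := hm (a + k) (by omega) (by omega)
    have h4 := norm_halfCot_sub (hθ.trans_le h1.1) h3 (by linarith : f (a + k + 2) - f (a + k + 1) < 1)
    rw [Finset.sum_Ico_succ_top (by omega)]
    have e : ∑ n ∈ Finset.Ico a (a + (k + 1)), expi (f n) + expi (f (a + (k + 1)))
        + halfCot (f (a + (k + 1) + 1) - f (a + (k + 1))) * expi (f (a + (k + 1) + 1))
        = (∑ n ∈ Finset.Ico a (a + k + 1), expi (f n)
          + halfCot (f (a + k + 1) - f (a + k)) * expi (f (a + k + 1)))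
          + (halfCot (f (a + k + 2) - f (a + k + 1)) - halfCot (f (a + k + 1) - f (a + k)))
            * expi (f (a + k + 1)) := by
      have e1 : a + (k + 1) = a + k + 1 := by ring
      rw [e1]
      linear_combination hk
    rw [e]
    refine (norm_add_le _ _).trans ?_
    rw [norm_mul, norm_expi, mul_one, h4]
    have e1 : a + (k + 1) = a + k + 1 := by ring
    rw [e1]
    have e2 : a + k + 2 = a + k + 1 + 1 := by ring
    rw [e2]
    linarith

/-- **Kusmin–Landau inequality**: differences which are nondecreasing and stay at distance `θ`
from the integers. -/
lemma kusmin_landau (f : ℕ → ℝ) (a b : ℕ) {θ : ℝ} (hθ : 0 < θ) (j : ℤ)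
    (hd : ∀ n, a ≤ n → n < b → j + θ ≤ f (n + 1) - f n ∧ f (n + 1) - f n ≤ j + 1 - θ)
    (hm : ∀ n, a ≤ n → n < b → f (n + 1) - f n ≤ f (n + 2) - f (n + 1)) :
    ‖∑ n ∈ Finset.Ico a b, expi (f n)‖ ≤ 2 / θ := by
  rcases le_or_gt b a with hab | hab
  · rw [Finset.Ico_eq_empty_of_le hab]; simp; positivity
  obtain ⟨k, rfl⟩ : ∃ k, b = a + k + 1 := ⟨b - a - 1, by omega⟩
  -- Subtracting `j * n` leaves the characters unchanged and moves the differences into `[θ, 1 -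
  -- θ]`.
  set g : ℕ → ℝ := fun n => f n - j * n with hg
  have hfg : ∀ n, expi (f n) = expi (g n) := by
    intro n
    have : f n = g n + ((j * n : ℤ) : ℝ) := by simp [hg]
    rw [this, expi_add, expi_int, mul_one]
  simp_rw [hfg]
  have hd' : ∀ n, a ≤ n → n ≤ a + k → θ ≤ g (n + 1) - g n ∧ g (n + 1) - g n ≤ 1 - θ := by
    intro n h1 h2
    have := hd n h1 (by omega)
    simp only [hg]; push_cast
    constructor <;> nlinarith
  have h := norm_sum_expi_add_halfCot_le g a hθ k hd' (by
    intro n h1 h2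
    have := hm n h1 (by omega)
    simp only [hg]; push_cast
    nlinarith)
  have h1 := hd' a le_rfl (by omega)
  have h2 := hd' (a + k) (by omega) le_rfl
  have h3 := abs_le.1 (abs_cotPi_le hθ h1.1 h1.2)
  have h4 := abs_le.1 (abs_cotPi_le hθ h2.1 h2.2)
  have h5 := norm_halfCot_le hθ h2.1 h2.2
  have h6 : ‖∑ n ∈ Finset.Ico a (a + k + 1), expi (g n)‖ ≤
      ‖∑ n ∈ Finset.Ico a (a + k + 1), expi (g n)
        + halfCot (g (a + k + 1) - g (a + k)) * expi (g (a + k + 1))‖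
      + ‖halfCot (g (a + k + 1) - g (a + k)) * expi (g (a + k + 1))‖ := by
    have := norm_sub_le (∑ n ∈ Finset.Ico a (a + k + 1), expi (g n)
        + halfCot (g (a + k + 1) - g (a + k)) * expi (g (a + k + 1)))
        (halfCot (g (a + k + 1) - g (a + k)) * expi (g (a + k + 1)))
    simpa using this
  rw [norm_mul (halfCot _), norm_expi, mul_one] at h6
  have h7 : 1 / (2 * θ) = (1 / θ) / 2 := by field_simp
  have h8 : 2 / θ = 2 * (1 / θ) := by ring
  have h9 : 0 < 1 / θ := by positivity
  rw [h7] at h h3 h4 h5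
  rw [h8]
  linarith [h3.1, h3.2, h4.1, h4.2]

lemma eq_Ico_of_ordConnected (s : Finset ℕ)
    (h : ∀ x ∈ s, ∀ z ∈ s, ∀ y, x ≤ y → y ≤ z → y ∈ s) : ∃ p q, s = Finset.Ico p q := by
  rcases s.eq_empty_or_nonempty with rfl | hs
  · exact ⟨0, 0, by simp⟩
  · refine ⟨s.min' hs, s.max' hs + 1, ?_⟩
    ext y
    rw [Finset.mem_Ico]
    constructor
    · intro hy
      exact ⟨s.min'_le _ hy, Nat.lt_succ_of_le (s.le_max' _ hy)⟩
    · rintro ⟨h1, h2⟩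
      exact h _ (s.min'_mem hs) _ (s.max'_mem hs) y h1 (Nat.le_of_lt_succ h2)

/-! ### Van der Corput's second derivative test. -/

section VanDerCorput

variable {f : ℕ → ℝ} {a b : ℕ} {lam : ℝ}

lemma mul_sub_le_diff_sub (hlam : ∀ n, a ≤ n → n < b →
      lam ≤ (f (n + 2) - f (n + 1)) - (f (n + 1) - f n))
    {p q : ℕ} (hp : a ≤ p) (hpq : p ≤ q) (hq : q ≤ b) :
    lam * ((q : ℝ) - p) ≤ (f (q + 1) - f q) - (f (p + 1) - f p) := by
  induction q, hpq using Nat.le_induction with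
  | base => simp
  | succ q hpq ih =>
    have h1 := ih (by omega)
    have h2 := hlam q (by omega) (by omega)
    push_cast
    have e : q + 1 + 1 = q + 2 := by ring
    rw [e]
    nlinarith

lemma diff_sub_le_mul_sub (hlam : ∀ n, a ≤ n → n < b →
      (f (n + 2) - f (n + 1)) - (f (n + 1) - f n) ≤ lam)
    {p q : ℕ} (hp : a ≤ p) (hpq : p ≤ q) (hq : q ≤ b) :
    (f (q + 1) - f q) - (f (p + 1) - f p) ≤ lam * ((q : ℝ) - p) := by
  induction q, hpq using Nat.le_induction with
  | base => simp
  | succ q hpq ih =>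
    have h1 := ih (by omega)
    have h2 := hlam q (by omega) (by omega)
    push_cast
    have e : q + 1 + 1 = q + 2 := by ring
    rw [e]
    nlinarith

/-- The first differences increase with `n`, so those lying in an order-connected set come from
consecutive indices. -/
lemma filter_diff_eq_Ico (hpos : 0 < lam) (hlam : ∀ n, a ≤ n → n < b →
      lam ≤ (f (n + 2) - f (n + 1)) - (f (n + 1) - f n)) (I : Set ℝ) [DecidablePred (· ∈ I)]
    (hI : I.OrdConnected) :
    ∃ p q, (Finset.Ico a b).filter (fun n => f (n + 1) - f n ∈ I) = Finset.Ico p q := by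
  apply eq_Ico_of_ordConnected
  intro x hx z hz y hxy hyz
  rw [Finset.mem_filter, Finset.mem_Ico] at *
  refine ⟨by omega, hI.out hx.2 hz.2 ⟨?_, ?_⟩⟩
  · have := mul_sub_le_diff_sub hlam hx.1.1 hxy (by omega)
    have h2 : (0 : ℝ) ≤ y - x := by rw [sub_nonneg]; exact_mod_cast hxy
    nlinarith [mul_nonneg hpos.le h2]
  · have := mul_sub_le_diff_sub hlam (hx.1.1.trans hxy) hyz (by omega)
    have h2 : (0 : ℝ) ≤ z - y := by rw [sub_nonneg]; exact_mod_cast hyz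
    nlinarith [mul_nonneg hpos.le h2]

lemma norm_sum_filter_diff_short (hpos : 0 < lam) (hlam : ∀ n, a ≤ n → n < b →
      lam ≤ (f (n + 2) - f (n + 1)) - (f (n + 1) - f n)) (I : Set ℝ) [DecidablePred (· ∈ I)]
    (hI : I.OrdConnected) {θ : ℝ} (hθ : 0 ≤ θ) (hd : ∀ x ∈ I, ∀ y ∈ I, y - x ≤ θ) :
    ‖∑ n ∈ (Finset.Ico a b).filter (fun n => f (n + 1) - f n ∈ I), expi (f n)‖ ≤ θ / lam + 1 := by
  refine (norm_sum_expi_le _ _).trans ?_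
  obtain ⟨p, q, hpq⟩ := filter_diff_eq_Ico hpos hlam I hI
  rw [hpq, Nat.card_Ico]
  rcases le_or_gt q p with h | h
  · rw [Nat.sub_eq_zero_of_le h]; simp; positivity
  have hp : p ∈ (Finset.Ico a b).filter (fun n => f (n + 1) - f n ∈ I) := by
    rw [hpq, Finset.mem_Ico]; omega
  have hq : q - 1 ∈ (Finset.Ico a b).filter (fun n => f (n + 1) - f n ∈ I) := by
    rw [hpq, Finset.mem_Ico]; omega
  rw [Finset.mem_filter, Finset.mem_Ico] at hp hq
  have h1 := mul_sub_le_diff_sub hlam hp.1.1 (by omega : p ≤ q - 1) (by omega)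
  have h2 := hd _ hp.2 _ hq.2
  obtain ⟨k, rfl⟩ : ∃ k, q = p + k + 1 := ⟨q - p - 1, by omega⟩
  have e : p + k + 1 - p = k + 1 := by omega
  have e2 : p + k + 1 - 1 = p + k := by omega
  rw [e2] at h1 h2
  rw [e]
  push_cast at h1 ⊢
  have : (k : ℝ) ≤ θ / lam := by rw [le_div_iff₀ hpos]; linarith
  linarith

/-- **Van der Corput's second derivative test** for sequences with second differences in
`[lam, α * lam]`. -/
theorem van_der_corput {α : ℝ} (hpos : 0 < lam) (hα : 1 ≤ α) (hab : a ≤ b)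
    (hlam : ∀ n, a ≤ n → n < b → lam ≤ (f (n + 2) - f (n + 1)) - (f (n + 1) - f n))
    (hup : ∀ n, a ≤ n → n < b → (f (n + 2) - f (n + 1)) - (f (n + 1) - f n) ≤ α * lam) :
    ‖∑ n ∈ Finset.Ico a b, expi (f n)‖
      ≤ 10 * (α * ((b : ℝ) - a) * √lam + 1 / √lam) := by
  set r := √lam with hr
  have hr0 : 0 < r := Real.sqrt_pos.2 hpos
  have hrr : r * r = lam := Real.mul_self_sqrt hpos.le
  have hL : (0 : ℝ) ≤ (b : ℝ) - a := by rw [sub_nonneg]; exact_mod_cast hab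
  have hαL : (b : ℝ) - a ≤ α * ((b : ℝ) - a) := by nlinarith
  -- For `√lam ≥ 1/4` counting the terms is already enough.
  rcases le_or_gt (1 / 4) r with h4 | h4
  · have h1 := norm_sum_expi_le (Finset.Ico a b) f
    rw [Nat.card_Ico, Nat.cast_sub hab] at h1
    have h2 : 0 < 1 / r := by positivity
    nlinarith [mul_le_mul_of_nonneg_left h4 (hL.trans hαL)]
  -- Among the `n` whose difference has integer part `j`, those within `r` of an end of `[j, j + 1)`
  -- number at most `r / lam + 1 = 1 / r + 1` at each end, and Kusmin–Landau with `θ = r` bounds the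
  -- rest by `2 / r`. The choice `r = √lam` balances the two; `r < 1/4` keeps the three ranges
  -- disjoint and absorbs the two units.
  have hfib : ∀ j : ℤ,
      ‖∑ n ∈ (Finset.Ico a b).filter (fun n => ⌊f (n + 1) - f n⌋ = j), expi (f n)‖ ≤ 5 / r := by
    intro j
    classical
    have hsplit : ∑ n ∈ (Finset.Ico a b).filter (fun n => ⌊f (n + 1) - f n⌋ = j), expi (f n)
        = ∑ n ∈ (Finset.Ico a b).filter (fun n => f (n + 1) - f n ∈ Set.Ico (j : ℝ) (j + r)),
            expi (f n)
        + ∑ n ∈ (Finset.Ico a b).filter (fun n => f (n + 1) - f n ∈ Set.Icc (j + r) (j + 1 - r)),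
            expi (f n)
        + ∑ n ∈ (Finset.Ico a b).filter (fun n => f (n + 1) - f n ∈ Set.Ioo (j + 1 - r) (j + 1)),
            expi (f n) := by
      simp only [Finset.sum_filter]
      rw [← Finset.sum_add_distrib, ← Finset.sum_add_distrib]
      refine Finset.sum_congr rfl fun n _ => ?_
      simp only [Int.floor_eq_iff, Set.mem_Ico, Set.mem_Icc, Set.mem_Ioo]
      set x := f (n + 1) - f n
      split_ifs <;> first | simp; done | (exfalso; grind)
    have h1 := norm_sum_filter_diff_short hpos hlam (Set.Ico (j : ℝ) (j + r)) Set.ordConnected_Ico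
      hr0.le (fun x hx y hy => by linarith [hx.1, hy.2])
    have h3 := norm_sum_filter_diff_short hpos hlam (Set.Ioo (j + 1 - r : ℝ) (j + 1))
      Set.ordConnected_Ioo hr0.le (fun x hx y hy => by linarith [hx.1, hy.2])
    have h2 : ‖∑ n ∈ (Finset.Ico a b).filter
        (fun n => f (n + 1) - f n ∈ Set.Icc (j + r) (j + 1 - r)), expi (f n)‖ ≤ 2 / r := by
      obtain ⟨p, q, hpq⟩ := filter_diff_eq_Ico hpos hlam (Set.Icc (j + r) (j + 1 - r : ℝ))
        Set.ordConnected_Icc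
      rw [hpq]
      have hmem : ∀ n, p ≤ n → n < q → (a ≤ n ∧ n < b) ∧
          f (n + 1) - f n ∈ Set.Icc (j + r) (j + 1 - r) := by
        intro n h1 h2
        have : n ∈ Finset.Ico p q := Finset.mem_Ico.2 ⟨h1, h2⟩
        rwa [← hpq, Finset.mem_filter, Finset.mem_Ico] at this
      refine kusmin_landau f p q hr0 j (fun n h1 h2 => (hmem n h1 h2).2) (fun n h1 h2 => ?_)
      have := hlam n (hmem n h1 h2).1.1 (hmem n h1 h2).1.2
      linarith
    rw [hsplit]
    refine (norm_add₃_le).trans ?_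
    have e : r / lam = 1 / r := by rw [← hrr]; field_simp
    rw [e] at h1 h3
    have e2 : 5 / r = 1 / r + 2 / r + 1 / r + 1 / r := by ring
    have e3 : 4 ≤ 1 / r := by rw [le_div_iff₀ hr0]; linarith
    linarith
  have hmaps : ∀ n ∈ Finset.Ico a b,
      ⌊f (n + 1) - f n⌋ ∈ Finset.Icc ⌊f (a + 1) - f a⌋ ⌊f (b + 1) - f b⌋ := by
    intro n hn
    rw [Finset.mem_Ico] at hn
    rw [Finset.mem_Icc]
    have h1 := mul_sub_le_diff_sub hlam le_rfl hn.1 hn.2.le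
    have h2 := mul_sub_le_diff_sub hlam hn.1 hn.2.le le_rfl
    have h3 : (0 : ℝ) ≤ n - a := by rw [sub_nonneg]; exact_mod_cast hn.1
    have h4 : (0 : ℝ) ≤ b - n := by rw [sub_nonneg]; exact_mod_cast hn.2.le
    exact ⟨Int.floor_mono (by nlinarith [mul_nonneg hpos.le h3]),
      Int.floor_mono (by nlinarith [mul_nonneg hpos.le h4])⟩
  rw [← Finset.sum_fiberwise_of_maps_to hmaps]
  refine (norm_sum_le_of_le _ (fun j _ => hfib j)).trans ?_
  rw [Finset.sum_const, nsmul_eq_mul, Int.card_Icc]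
  -- The first difference grows by at most `α * lam` per step, which bounds the number of integer
  -- parts it can have.
  have hcard : (((⌊f (b + 1) - f b⌋ + 1 - ⌊f (a + 1) - f a⌋).toNat : ℕ) : ℝ)
      ≤ α * lam * ((b : ℝ) - a) + 2 := by
    have h1 := diff_sub_le_mul_sub hup le_rfl hab le_rfl
    have h0 := mul_sub_le_diff_sub hlam le_rfl hab le_rfl
    have h2 : ⌊f (a + 1) - f a⌋ ≤ ⌊f (b + 1) - f b⌋ :=
      Int.floor_mono (by nlinarith [mul_nonneg hpos.le hL])
    have h3 : (((⌊f (b + 1) - f b⌋ + 1 - ⌊f (a + 1) - f a⌋).toNat : ℤ))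
        = ⌊f (b + 1) - f b⌋ + 1 - ⌊f (a + 1) - f a⌋ := Int.toNat_of_nonneg (by omega)
    have h4 : (((⌊f (b + 1) - f b⌋ + 1 - ⌊f (a + 1) - f a⌋).toNat : ℕ) : ℝ)
        = (⌊f (b + 1) - f b⌋ : ℝ) + 1 - ⌊f (a + 1) - f a⌋ := by exact_mod_cast h3
    rw [h4]
    linarith [Int.floor_le (f (b + 1) - f b), Int.lt_floor_add_one (f (a + 1) - f a)]
  refine (mul_le_mul_of_nonneg_right hcard (by positivity)).trans ?_
  have e : (α * lam * ((b : ℝ) - a) + 2) * (5 / r)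
      = 5 * (α * ((b : ℝ) - a) * r) + 10 * (1 / r) := by
    rw [← hrr]; field_simp; ring
  rw [e]
  have : 0 ≤ α * ((b : ℝ) - a) * r := mul_nonneg (hL.trans hαL) hr0.le
  linarith

end VanDerCorput

/-! ### Discrepancy with additive twists, by way of the sawtooth function. -/

/-- The first periodic Bernoulli function. -/
noncomputable def saw (x : ℝ) : ℝ := Int.fract x - 1 / 2

/-- The second periodic Bernoulli function. -/
noncomputable def bern (x : ℝ) : ℝ := Int.fract x ^ 2 - Int.fract x + 1 / 6

/-- The mean of the sawtooth function over `[x, x + δ]`. -/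
noncomputable def sawMean (δ x : ℝ) : ℝ := (bern (x + δ) - bern x) / (2 * δ)

lemma fract_add_of_lt {x δ : ℝ} (h0 : 0 ≤ δ) (h : Int.fract x + δ < 1) :
    Int.fract (x + δ) = Int.fract x + δ := by
  rw [Int.fract_eq_iff]
  refine ⟨by linarith [Int.fract_nonneg x], h, ⌊x⌋, ?_⟩
  linarith [Int.floor_add_fract x]

lemma fract_add_of_ge {x δ : ℝ} (h1 : δ ≤ 1) (h : 1 ≤ Int.fract x + δ) :
    Int.fract (x + δ) = Int.fract x + δ - 1 := by
  rw [Int.fract_eq_iff]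
  refine ⟨by linarith, by linarith [Int.fract_lt_one x], ⌊x⌋ + 1, ?_⟩
  push_cast
  linarith [Int.floor_add_fract x]

lemma fract_sub_of_le {x δ : ℝ} (h0 : 0 ≤ δ) (h : δ ≤ Int.fract x) :
    Int.fract (x - δ) = Int.fract x - δ := by
  rw [Int.fract_eq_iff]
  refine ⟨by linarith, by linarith [Int.fract_lt_one x], ⌊x⌋, ?_⟩
  linarith [Int.floor_add_fract x]

lemma fract_sub_of_lt {x δ : ℝ} (h1 : δ ≤ 1) (h : Int.fract x < δ) :
    Int.fract (x - δ) = Int.fract x - δ + 1 := by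
  rw [Int.fract_eq_iff]
  refine ⟨by linarith [Int.fract_nonneg x], by linarith, ⌊x⌋ - 1, ?_⟩
  push_cast
  linarith [Int.floor_add_fract x]

/-- The sawtooth rises with slope `1` and only jumps downwards, so its mean to the right of `x`
exceeds its value at `x` by at most `δ / 2`. `saw_le` is the mirror image. -/
lemma sawMean_le {δ : ℝ} (h0 : 0 < δ) (h1 : δ ≤ 1) (x : ℝ) : sawMean δ x ≤ saw x + δ / 2 := by
  rw [sawMean, div_le_iff₀ (by positivity), saw, bern, bern]
  have := Int.fract_nonneg x
  have := Int.fract_lt_one x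
  rcases lt_or_ge (Int.fract x + δ) 1 with h | h
  · rw [fract_add_of_lt h0.le h]; nlinarith
  · rw [fract_add_of_ge h1 h]; nlinarith

lemma saw_le {δ : ℝ} (h0 : 0 < δ) (h1 : δ ≤ 1) (x : ℝ) : saw x ≤ sawMean δ (x - δ) + δ / 2 := by
  rw [sawMean, ← sub_le_iff_le_add, le_div_iff₀ (by positivity), sub_add_cancel, saw, bern, bern]
  have := Int.fract_nonneg x
  have := Int.fract_lt_one x
  rcases lt_or_ge (Int.fract x) δ with h | h
  · rw [fract_sub_of_lt h1 h]; nlinarith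
  · rw [fract_sub_of_le h0.le h]; nlinarith

/-- The smoothing error is majorized by smoothed sawtooths again, so it can be summed with the same
exponential sums, at frequency zero. The two one-sided bounds give `sawMean δ (x - δ) - sawMean δ x
≥ -δ`, hence `2 * δ` is enough for the lower bound too. -/
lemma abs_saw_sub_sawMean_le {δ : ℝ} (h0 : 0 < δ) (h1 : δ ≤ 1) (x : ℝ) :
    |saw x - sawMean δ x| ≤ sawMean δ (x - δ) - sawMean δ x + 2 * δ := by
  have := sawMean_le h0 h1 x
  have := saw_le h0 h1 x
  rw [abs_le]
  constructor <;> linarith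

lemma indicator_fract_lt_sub {x u : ℝ} (h0 : 0 ≤ u) (h1 : u ≤ 1) :
    (if Int.fract x < u then (1 : ℝ) else 0) - u = saw (x - u) - saw x := by
  rw [saw, saw]
  split_ifs with h
  · rw [fract_sub_of_lt h1 h]; ring
  · rw [fract_sub_of_le h0 (not_lt.1 h)]; ring

/-- The Fourier series of the second Bernoulli polynomial; the spurious term `m = 0` vanishes since
division by zero gives `0`. -/
lemma hasSum_bern (x : ℝ) :
    HasSum (fun m : ℕ => (expi (m * x)).re / (Real.pi ^ 2 * (m : ℝ) ^ 2)) (bern x) := by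
  have hf : Int.fract x ∈ Set.Icc (0 : ℝ) 1 := ⟨Int.fract_nonneg x, (Int.fract_lt_one x).le⟩
  have h := (hasSum_one_div_nat_pow_mul_cos one_ne_zero hf).mul_left (1 / Real.pi ^ 2)
  have hB : Polynomial.eval (Int.fract x)
      (Polynomial.map (algebraMap ℚ ℝ) (Polynomial.bernoulli (2 * 1))) = bern x := by
    simp only [mul_one, Polynomial.eval_map_algebraMap]
    rw [Polynomial.bernoulli]
    simp [Finset.sum_range_succ, bernoulli_eq_bernoulli'_of_ne_one, bernoulli'_two, bern,
      bernoulli_one]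
    ring
  rw [hB] at h
  have hv : 1 / Real.pi ^ 2 * ((-1) ^ (1 + 1) * (2 * Real.pi) ^ (2 * 1) / 2 /
      ((2 * 1).factorial : ℝ) * bern x) = bern x := by
    have := Real.pi_pos.ne'
    simp
    field_simp
  rw [hv] at h
  refine Eq.mp (congrArg (fun F => HasSum F _) (funext fun m => ?_)) h
  symm
  have e : Real.cos (2 * Real.pi * m * Int.fract x) = Real.cos (2 * Real.pi * (m * x)) := by
    rw [← Int.self_sub_floor, ← Real.cos_sub_int_mul_two_pi (2 * Real.pi * (m * x)) (m * ⌊x⌋)]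
    congr 1
    push_cast; ring
  rw [expi_re, e]
  simp only [mul_one]
  ring

lemma hasSum_sawMean (δ x : ℝ) :
    HasSum (fun m : ℕ => (expi (m * x) * (expi (m * δ) - 1)).re
      / (2 * δ * (Real.pi ^ 2 * (m : ℝ) ^ 2))) (sawMean δ x) := by
  have h := ((hasSum_bern (x + δ)).sub (hasSum_bern x)).div_const (2 * δ)
  rw [sawMean]
  refine Eq.mp (congrArg (fun F => HasSum F _) (funext fun m => ?_)) h
  symm
  rw [mul_add, expi_add, ← sub_div, ← Complex.sub_re, div_div, mul_sub, mul_one]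
  congr 1
  ring

/-- The sum of the series `∑ m ^ (-3/2)`. -/
noncomputable def zetaThreeHalves : ℝ := ∑' m : ℕ, 1 / (m : ℝ) ^ (3 / 2 : ℝ)

lemma hasSum_zetaThreeHalves :
    HasSum (fun m : ℕ => 1 / (m : ℝ) ^ (3 / 2 : ℝ)) zetaThreeHalves :=
  (Real.summable_one_div_nat_rpow.2 (by norm_num)).hasSum

lemma zetaThreeHalves_nonneg : 0 ≤ zetaThreeHalves :=
  tsum_nonneg fun m => by positivity

section Discrepancy

variable {J : Finset ℕ} {t : ℕ → ℝ} {A B δ : ℝ}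

/-- The coefficients carry the factor `(e(mδ) - 1) / (δ m²)`. Bounding `|e(mδ) - 1|` by `2` against
`A √m`, and by `2π m δ` against `B / √m`, turns both into multiples of `m^(-3/2)`, so no truncation
of the series is needed. -/
lemma norm_sum_sawMean_le (hA : 0 ≤ A) (hB : 0 ≤ B) (hδ : 0 < δ)
    (h : ∀ m : ℕ, 1 ≤ m → ∀ ξ : ℝ,
      ‖∑ n ∈ J, expi (m * t n + n * ξ)‖ ≤ A * √m + B / √m) (θ ξ : ℝ) :
    ‖∑ n ∈ J, (sawMean δ (t n + θ) : ℂ) * expi (n * ξ)‖ ≤ (A / δ + B) * zetaThreeHalves := by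
  have hs : HasSum (fun m : ℕ => ∑ n ∈ J, (((expi (m * (t n + θ)) * (expi (m * δ) - 1)).re
      / (2 * δ * (Real.pi ^ 2 * (m : ℝ) ^ 2)) : ℝ) : ℂ) * expi (n * ξ))
      (∑ n ∈ J, (sawMean δ (t n + θ) : ℂ) * expi (n * ξ)) :=
    hasSum_sum fun n _ => (Complex.hasSum_ofReal.2 (hasSum_sawMean δ (t n + θ))).mul_right _
  rw [← hs.tsum_eq]
  refine tsum_of_norm_bounded (hasSum_zetaThreeHalves.mul_left (A / δ + B)) fun m => ?_
  rcases Nat.eq_zero_or_pos m with rfl | hm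
  · simp
  have hm0 : (0 : ℝ) < m := by exact_mod_cast hm
  have hpi := Real.pi_gt_three
  set w := expi (m * θ) * (expi (m * δ) - 1) with hw
  -- Writing the real part as half the sum with the conjugate produces the frequency `-m`, which is
  -- the conjugate of the sum at `m` with `ξ` replaced by `-ξ`.
  have hterm : ∑ n ∈ J, (((expi (m * (t n + θ)) * (expi (m * δ) - 1)).re
      / (2 * δ * (Real.pi ^ 2 * (m : ℝ) ^ 2)) : ℝ) : ℂ) * expi (n * ξ)
      = ((1 / (4 * δ * (Real.pi ^ 2 * (m : ℝ) ^ 2)) : ℝ) : ℂ) *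
        (w * ∑ n ∈ J, expi (m * t n + n * ξ)
          + (starRingEnd ℂ) w * (starRingEnd ℂ) (∑ n ∈ J, expi (m * t n + n * (-ξ)))) := by
    rw [map_sum, Finset.mul_sum, Finset.mul_sum, ← Finset.sum_add_distrib, Finset.mul_sum]
    refine Finset.sum_congr rfl fun n _ => ?_
    rw [← expi_neg, show -(m * t n + n * (-ξ)) = -(m * t n) + n * ξ by ring, expi_add, expi_add,
      expi_neg, mul_add, expi_add, Complex.ofReal_div, Complex.re_eq_add_conj,
      show expi (↑m * t n) * expi (↑m * θ) * (expi (↑m * δ) - 1) = expi (m * t n) * w by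
        rw [hw]; ring, map_mul]
    push_cast
    field_simp
    ring
  rw [hterm, norm_mul, Complex.norm_real, Real.norm_eq_abs, abs_of_nonneg (by positivity)]
  have hwn : ‖w‖ = ‖expi (m * δ) - 1‖ := by rw [hw, norm_mul, norm_expi, one_mul]
  have hS1 := h m hm ξ
  have hS2 := h m hm (-ξ)
  have hr : 0 < √(m : ℝ) := Real.sqrt_pos.2 hm0
  have hrr : √(m : ℝ) * √m = m := Real.mul_self_sqrt hm0.le
  have h1 : ‖w * ∑ n ∈ J, expi (m * t n + n * ξ)
      + (starRingEnd ℂ) w * (starRingEnd ℂ) (∑ n ∈ J, expi (m * t n + n * (-ξ)))‖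
      ≤ 2 * (‖w‖ * (A * √m + B / √m)) := by
    refine (norm_add_le _ _).trans ?_
    rw [norm_mul w, norm_mul (starRingEnd ℂ w), RCLike.norm_conj, RCLike.norm_conj, two_mul]
    gcongr
  have h2 : ‖w‖ * (A * √m + B / √m) ≤ 2 * (A * √m) + 2 * Real.pi * (m * δ) * (B / √m) := by
    rw [mul_add, hwn]
    have := norm_expi_sub_one_le (m * δ)
    rw [abs_of_pos (by positivity)] at this
    have h3 := norm_expi_sub_one_le_two (m * δ)
    gcongr
  have h32 : (m : ℝ) ^ (3 / 2 : ℝ) = m * √m := by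
    rw [Real.sqrt_eq_rpow, ← Real.rpow_one_add' hm0.le (by norm_num)]
    norm_num
  refine (mul_le_mul_of_nonneg_left (h1.trans (mul_le_mul_of_nonneg_left h2 zero_le_two))
    (by positivity)).trans ?_
  rw [h32]
  have e : 1 / (4 * δ * (Real.pi ^ 2 * (m : ℝ) ^ 2)) *
      (2 * (2 * (A * √m) + 2 * Real.pi * (m * δ) * (B / √m)))
      = (A / δ * (1 / Real.pi ^ 2) + B * (1 / Real.pi)) * (1 / (m * √m)) := by
    generalize √(m : ℝ) = r at *
    rw [← hrr]
    field_simp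
    ring
  rw [e]
  have h5 : 1 / Real.pi ≤ 1 := by rw [div_le_one (by positivity)]; linarith
  have h6 : 1 / Real.pi ^ 2 ≤ 1 := by rw [div_le_one (by positivity)]; nlinarith
  have h7 : 0 ≤ A / δ := by positivity
  gcongr
  · nlinarith
  · nlinarith

lemma norm_sum_saw_le (hA : 0 ≤ A) (hB : 0 ≤ B) (hδ : 0 < δ) (hδ1 : δ ≤ 1)
    (h : ∀ m : ℕ, 1 ≤ m → ∀ ξ : ℝ,
      ‖∑ n ∈ J, expi (m * t n + n * ξ)‖ ≤ A * √m + B / √m) (θ ξ : ℝ) :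
    ‖∑ n ∈ J, (saw (t n + θ) : ℂ) * expi (n * ξ)‖
      ≤ 3 * ((A / δ + B) * zetaThreeHalves) + 2 * δ * J.card := by
  have h1 := norm_sum_sawMean_le hA hB hδ h θ ξ
  have h2 := norm_sum_sawMean_le hA hB hδ h (θ - δ) 0
  have h3 := norm_sum_sawMean_le hA hB hδ h θ 0
  simp only [mul_zero, expi_zero, mul_one, ← Complex.ofReal_sum, Complex.norm_real,
    Real.norm_eq_abs] at h2 h3
  have h4 : ‖∑ n ∈ J, ((saw (t n + θ) - sawMean δ (t n + θ) : ℝ) : ℂ) * expi (n * ξ)‖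
      ≤ ∑ n ∈ J, (sawMean δ (t n + (θ - δ)) - sawMean δ (t n + θ) + 2 * δ) := by
    refine norm_sum_le_of_le _ fun n _ => ?_
    rw [norm_mul, norm_expi, mul_one, Complex.norm_real, Real.norm_eq_abs, ← add_sub_assoc]
    exact abs_saw_sub_sawMean_le hδ hδ1 _
  rw [Finset.sum_add_distrib, Finset.sum_sub_distrib, Finset.sum_const, nsmul_eq_mul] at h4
  have e : ∑ n ∈ J, (saw (t n + θ) : ℂ) * expi (n * ξ)
      = ∑ n ∈ J, (sawMean δ (t n + θ) : ℂ) * expi (n * ξ)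
        + ∑ n ∈ J, ((saw (t n + θ) - sawMean δ (t n + θ) : ℝ) : ℂ) * expi (n * ξ) := by
    rw [← Finset.sum_add_distrib]
    refine Finset.sum_congr rfl fun n _ => ?_
    push_cast; ring
  rw [e]
  refine (norm_add_le _ _).trans ?_
  linarith [abs_le.1 h2, abs_le.1 h3, (abs_le.1 h2).2, (abs_le.1 h3).1]

/-- A discrepancy bound of Erdős–Turán type with additive twists. -/
theorem norm_sum_indicator_fract_lt_sub_le (hA : 0 ≤ A) (hB : 0 ≤ B) (hδ : 0 < δ) (hδ1 : δ ≤ 1)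
    (h : ∀ m : ℕ, 1 ≤ m → ∀ ξ : ℝ,
      ‖∑ n ∈ J, expi (m * t n + n * ξ)‖ ≤ A * √m + B / √m)
    {u : ℝ} (hu0 : 0 ≤ u) (hu1 : u ≤ 1) (ξ : ℝ) :
    ‖∑ n ∈ J, (((if Int.fract (t n) < u then (1 : ℝ) else 0) - u : ℝ) : ℂ) * expi (n * ξ)‖
      ≤ 6 * ((A / δ + B) * zetaThreeHalves) + 4 * δ * J.card := by
  have h1 := norm_sum_saw_le hA hB hδ hδ1 h (-u) ξ
  have h2 := norm_sum_saw_le hA hB hδ hδ1 h 0 ξ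
  simp_rw [indicator_fract_lt_sub hu0 hu1]
  have e : ∑ n ∈ J, ((saw (t n - u) - saw (t n) : ℝ) : ℂ) * expi (n * ξ)
      = ∑ n ∈ J, (saw (t n + -u) : ℂ) * expi (n * ξ)
        - ∑ n ∈ J, (saw (t n + 0) : ℂ) * expi (n * ξ) := by
    rw [← Finset.sum_sub_distrib]
    refine Finset.sum_congr rfl fun n _ => ?_
    rw [add_zero, ← sub_eq_add_neg]
    push_cast; ring
  rw [e]
  refine (norm_sub_le _ _).trans ?_
  linarith

end Discrepancy

/-! ### Moving thresholds: freezing the weight on short blocks. -/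

section Blocks

variable {t v : ℕ → ℝ}

/-- The error of freezing `v` at `u₀` is majorized by a combination of indicators with fixed
thresholds, whose sums the discrepancy bound evaluates. -/
lemma abs_weight_sub_le {x v u₀ u₁ : ℝ} (h0 : 0 < u₀) (h1 : u₀ ≤ v) (h2 : v ≤ u₁) :
    |(if x < v then v⁻¹ else 0) - u₀⁻¹ * (if x < u₀ then (1 : ℝ) else 0)|
      ≤ u₀⁻¹ * (if x < u₁ then (1 : ℝ) else 0) - u₁⁻¹ * (if x < u₀ then (1 : ℝ) else 0) := by
  have i1 : v⁻¹ ≤ u₀⁻¹ := inv_anti₀ h0 h1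
  have i2 : u₁⁻¹ ≤ v⁻¹ := inv_anti₀ (h0.trans_le h1) h2
  have i3 : 0 < u₁⁻¹ := inv_pos.2 (h0.trans_le (h1.trans h2))
  rw [abs_le]
  split_ifs <;> constructor <;> linarith

/-- The frozen sum costs `E / u₀`. The freezing error is summed in absolute value, so only `ξ = 0`
matters there: its main term is `|J| (u₁/u₀ - u₀/u₁)`, and the discrepancy is used twice more. -/
lemma norm_sum_block_le {J : Finset ℕ} {u₀ u₁ E : ℝ} (h0 : 0 < u₀) (h01 : u₀ ≤ u₁) (h1 : u₁ ≤ 1)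
    (hv : ∀ n ∈ J, u₀ ≤ v n ∧ v n ≤ u₁)
    (hE : ∀ u : ℝ, 0 ≤ u → u ≤ 1 → ∀ ξ : ℝ,
      ‖∑ n ∈ J, (((if Int.fract (t n) < u then (1 : ℝ) else 0) - u : ℝ) : ℂ) * expi (n * ξ)‖ ≤ E)
    (ξ : ℝ) :
    ‖∑ n ∈ J, (((if Int.fract (t n) < v n then (v n)⁻¹ else 0) - 1 : ℝ) : ℂ) * expi (n * ξ)‖
      ≤ 2 * J.card * (u₁ - u₀) / u₀ + 3 * E / u₀ := by
  have hu1 : 0 < u₁ := h0.trans_le h01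
  have hmean : ∀ u : ℝ, 0 ≤ u → u ≤ 1 →
      |∑ n ∈ J, (if Int.fract (t n) < u then (1 : ℝ) else 0) - J.card * u| ≤ E := by
    intro u hu hu'
    have := hE u hu hu' 0
    simpa only [mul_zero, expi_zero, mul_one, ← Complex.ofReal_sum, Complex.norm_real,
      Real.norm_eq_abs, Finset.sum_sub_distrib, Finset.sum_const, nsmul_eq_mul] using this
  have e : ∑ n ∈ J, (((if Int.fract (t n) < v n then (v n)⁻¹ else 0) - 1 : ℝ) : ℂ) * expi (n * ξ)
      = ∑ n ∈ J, (((if Int.fract (t n) < v n then (v n)⁻¹ else 0)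
          - u₀⁻¹ * (if Int.fract (t n) < u₀ then (1 : ℝ) else 0) : ℝ) : ℂ) * expi (n * ξ)
        + (u₀⁻¹ : ℝ) * ∑ n ∈ J, (((if Int.fract (t n) < u₀ then (1 : ℝ) else 0) - u₀ : ℝ) : ℂ)
          * expi (n * ξ) := by
    rw [Finset.mul_sum, ← Finset.sum_add_distrib]
    refine Finset.sum_congr rfl fun n _ => ?_
    rw [← mul_assoc, ← add_mul, ← Complex.ofReal_mul, ← Complex.ofReal_add]
    congr 3
    field_simp
    ring
  have b1 : ‖∑ n ∈ J, (((if Int.fract (t n) < v n then (v n)⁻¹ else 0)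
          - u₀⁻¹ * (if Int.fract (t n) < u₀ then (1 : ℝ) else 0) : ℝ) : ℂ) * expi (n * ξ)‖
      ≤ ∑ n ∈ J, (u₀⁻¹ * (if Int.fract (t n) < u₁ then (1 : ℝ) else 0)
          - u₁⁻¹ * (if Int.fract (t n) < u₀ then (1 : ℝ) else 0)) := by
    refine norm_sum_le_of_le _ fun n hn => ?_
    rw [norm_mul, norm_expi, mul_one, Complex.norm_real, Real.norm_eq_abs]
    exact abs_weight_sub_le h0 (hv n hn).1 (hv n hn).2
  rw [Finset.sum_sub_distrib, ← Finset.mul_sum, ← Finset.mul_sum] at b1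
  have b2 := abs_le.1 (hmean u₁ hu1.le h1)
  have b3 := abs_le.1 (hmean u₀ h0.le (h01.trans h1))
  have b4 := hE u₀ h0.le (h01.trans h1) ξ
  have hE0 : 0 ≤ E := (norm_nonneg _).trans b4
  set S₁ := ∑ n ∈ J, (if Int.fract (t n) < u₁ then (1 : ℝ) else 0)
  set S₀ := ∑ n ∈ J, (if Int.fract (t n) < u₀ then (1 : ℝ) else 0)
  have c1 : u₀⁻¹ * S₁ ≤ u₀⁻¹ * (J.card * u₁ + E) := by gcongr; linarith
  have c2 : u₁⁻¹ * (J.card * u₀ - E) ≤ u₁⁻¹ * S₀ := by gcongr; linarith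
  have c3 : u₁⁻¹ * E ≤ u₀⁻¹ * E := by gcongr
  have c4 : u₀⁻¹ * (J.card * u₁) - u₁⁻¹ * (J.card * u₀) ≤ 2 * J.card * (u₁ - u₀) / u₀ := by
    have hJ : (0 : ℝ) ≤ J.card := by positivity
    have : u₀⁻¹ * (J.card * u₁) - u₁⁻¹ * (J.card * u₀)
        = J.card * (u₁ - u₀) / u₀ * (1 + u₀ / u₁) := by field_simp; ring
    rw [this]
    have h5 : u₀ / u₁ ≤ 1 := by rw [div_le_one hu1]; exact h01
    have h6 : 0 ≤ J.card * (u₁ - u₀) / u₀ :=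
      div_nonneg (mul_nonneg hJ (by linarith)) h0.le
    calc _ ≤ J.card * (u₁ - u₀) / u₀ * (1 + 1) := by gcongr
      _ = _ := by ring
  rw [e]
  refine (norm_add_le _ _).trans ?_
  rw [norm_mul, Complex.norm_real, Real.norm_eq_abs, abs_of_pos (inv_pos.2 h0)]
  have c5 : u₀⁻¹ * ‖∑ n ∈ J, (((if Int.fract (t n) < u₀ then (1 : ℝ) else 0) - u₀ : ℝ) : ℂ)
          * expi (n * ξ)‖ ≤ u₀⁻¹ * E := by gcongr
  have c6 : 3 * E / u₀ = 3 * (u₀⁻¹ * E) := by rw [div_eq_mul_inv]; ring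
  rw [c6]
  nlinarith

/-- By monotonicity the oscillations of `v` over successive blocks telescope, so the freezing costs
`H * (v A / v B)` once for the whole range; only the discrepancy `E` is multiplied by the number of
blocks. -/
lemma norm_sum_weight_le {A B H : ℕ} {E : ℝ} (hAB : A ≤ B) (hH : 1 ≤ H)
    (hv : ∀ m n, A ≤ m → m ≤ n → n ≤ B → v n ≤ v m) (h0 : 0 < v B) (h1 : v A ≤ 1)
    (hE : ∀ a b, A ≤ a → a ≤ b → b ≤ B → b ≤ a + H → ∀ u : ℝ, 0 ≤ u → u ≤ 1 → ∀ ξ : ℝ,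
      ‖∑ n ∈ Finset.Ico a b, (((if Int.fract (t n) < u then (1 : ℝ) else 0) - u : ℝ) : ℂ)
        * expi (n * ξ)‖ ≤ E) (ξ : ℝ) :
    ‖∑ n ∈ Finset.Ico A B, (((if Int.fract (t n) < v n then (v n)⁻¹ else 0) - 1 : ℝ) : ℂ)
        * expi (n * ξ)‖
      ≤ 2 * H * (v A / v B) + 3 * (((B : ℝ) - A) / H + 1) * E / v B := by
  have hE0 : 0 ≤ E := (norm_nonneg _).trans (hE A A le_rfl le_rfl hAB (by omega) 0 le_rfl zero_le_one 0)
  -- The minimum allows a shorter last block, and empty blocks after it.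
  have key : ∀ k : ℕ, ‖∑ n ∈ Finset.Ico A (min (A + k * H) B),
        (((if Int.fract (t n) < v n then (v n)⁻¹ else 0) - 1 : ℝ) : ℂ) * expi (n * ξ)‖
      ≤ 2 * H * ((v A - v (min (A + k * H) B)) / v B) + 3 * k * E / v B := by
    intro k
    induction k with
    | zero => simp [hAB]
    | succ k ih =>
      set a := min (A + k * H) B with ha
      set b := min (A + (k + 1) * H) B with hb
      have e : (k + 1) * H = k * H + H := by ring
      rw [e] at hb
      have hAa : A ≤ a := by omega
      have hab : a ≤ b := by omega
      have hbB : b ≤ B := by omega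
      have hbH : b ≤ a + H := by omega
      rw [← Finset.sum_Ico_consecutive _ hAa hab]
      refine (norm_add_le _ _).trans ?_
      have hvb : 0 < v b := h0.trans_le (hv b B (hAa.trans hab) hbB le_rfl)
      have hvab := hv a b hAa hab hbB
      have h2 := norm_sum_block_le (t := t) (v := v) (J := Finset.Ico a b) hvb hvab
        ((hv A a le_rfl hAa (hab.trans hbB)).trans h1)
        (fun n hn => by
          rw [Finset.mem_Ico] at hn
          exact ⟨hv n b (hAa.trans hn.1) hn.2.le hbB, hv a n hAa hn.1 (by omega)⟩)
        (hE a b hAa hab hbB hbH) ξ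
      have h3 : 2 * ((Finset.Ico a b).card : ℝ) * (v a - v b) / v b
          ≤ 2 * H * ((v a - v b) / v B) := by
        rw [mul_div_assoc]
        have : ((Finset.Ico a b).card : ℝ) ≤ H := by
          rw [Nat.card_Ico]; exact_mod_cast (by omega : b - a ≤ H)
        have h4 : 0 ≤ v a - v b := by linarith
        gcongr
        exact hv b B (hAa.trans hab) hbB le_rfl
      have h4 : 3 * E / v b ≤ 3 * E / v B := by
        gcongr
        exact hv b B (hAa.trans hab) hbB le_rfl
      have h5 : 2 * H * ((v A - v b) / v B) + 3 * ((k + 1 : ℕ) : ℝ) * E / v B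
          = (2 * H * ((v A - v a) / v B) + 3 * k * E / v B)
            + (2 * H * ((v a - v b) / v B) + 3 * E / v B) := by
        push_cast; ring
      rw [h5]
      linarith
  have hk := key ((B - A) / H + 1)
  have hB : min (A + ((B - A) / H + 1) * H) B = B := by
    have := Nat.lt_div_mul_add (a := B - A) (b := H) (by omega)
    have e : ((B - A) / H + 1) * H = (B - A) / H * H + H := by ring
    rw [e]; omega
  rw [hB] at hk
  refine hk.trans ?_
  have h2 : (((B - A) / H + 1 : ℕ) : ℝ) ≤ ((B : ℝ) - A) / H + 1 := by
    push_cast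
    have := Nat.cast_div_le (α := ℝ) (m := B - A) (n := H)
    rw [Nat.cast_sub hAB] at this
    linarith
  have h3 : (v A - v B) / v B ≤ v A / v B := by gcongr; linarith
  gcongr

/-- Exponential sums along a sequence with second differences of constant sign and size. -/
lemma norm_sum_expi_twist_le {a b : ℕ} {lam α σ : ℝ} (hσ : σ = 1 ∨ σ = -1) (hpos : 0 < lam)
    (hα : 1 ≤ α) (hab : a ≤ b)
    (hlam : ∀ n, a ≤ n → n < b → lam ≤ σ * ((t (n + 2) - t (n + 1)) - (t (n + 1) - t n)))
    (hup : ∀ n, a ≤ n → n < b → σ * ((t (n + 2) - t (n + 1)) - (t (n + 1) - t n)) ≤ α * lam)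
    (m : ℕ) (hm : 1 ≤ m) (ξ : ℝ) :
    ‖∑ n ∈ Finset.Ico a b, expi (m * t n + n * ξ)‖
      ≤ 10 * (α * ((b : ℝ) - a) * √lam) * √m + 10 * (1 / √lam) / √m := by
  have hm0 : (0 : ℝ) < m := by exact_mod_cast hm
  -- The second differences are those of `m * t`, whatever `ξ` is. The sign `σ` makes them positive,
  -- and `σ = -1` only conjugates the sum.
  have h := van_der_corput (f := fun n => σ * (m * t n + n * ξ)) (a := a) (b := b)
    (lam := m * lam) (α := α) (by positivity) hα hab
    (fun n h1 h2 => by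
      have := mul_le_mul_of_nonneg_left (hlam n h1 h2) hm0.le
      push_cast
      linarith)
    (fun n h1 h2 => by
      have := mul_le_mul_of_nonneg_left (hup n h1 h2) hm0.le
      push_cast
      linarith)
  have e : ‖∑ n ∈ Finset.Ico a b, expi (m * t n + n * ξ)‖
      = ‖∑ n ∈ Finset.Ico a b, expi (σ * (m * t n + n * ξ))‖ := by
    rcases hσ with rfl | rfl
    · simp
    · simp_rw [neg_one_mul, expi_neg]
      rw [← map_sum, RCLike.norm_conj]
  rw [e]
  refine h.trans (le_of_eq ?_)
  rw [Real.sqrt_mul hm0.le]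
  field_simp

lemma norm_sum_weight_le_of_second_difference {A B H : ℕ} {lam α σ δ : ℝ}
    (hσ : σ = 1 ∨ σ = -1) (hpos : 0 < lam)
    (hα : 1 ≤ α) (hAB : A ≤ B) (hH : 1 ≤ H) (hδ : 0 < δ) (hδ1 : δ ≤ 1)
    (hlam : ∀ n, A ≤ n → n < B → lam ≤ σ * ((t (n + 2) - t (n + 1)) - (t (n + 1) - t n)))
    (hup : ∀ n, A ≤ n → n < B → σ * ((t (n + 2) - t (n + 1)) - (t (n + 1) - t n)) ≤ α * lam)
    (hv : ∀ m n, A ≤ m → m ≤ n → n ≤ B → v n ≤ v m) (h0 : 0 < v B) (h1 : v A ≤ 1) (ξ : ℝ) :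
    ‖∑ n ∈ Finset.Ico A B, (((if Int.fract (t n) < v n then (v n)⁻¹ else 0) - 1 : ℝ) : ℂ)
        * expi (n * ξ)‖
      ≤ 2 * H * (v A / v B) + 3 * (((B : ℝ) - A) / H + 1)
        * (6 * ((10 * (α * H * √lam) / δ + 10 * (1 / √lam)) * zetaThreeHalves) + 4 * δ * H)
        / v B := by
  refine norm_sum_weight_le hAB hH hv h0 h1 (fun a b hAa hab hbB hbH u hu0 hu1 η => ?_) ξ
  have hba : (b : ℝ) - a ≤ H := by
    rw [sub_le_iff_le_add']; exact_mod_cast hbH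
  have hba0 : (0 : ℝ) ≤ (b : ℝ) - a := by rw [sub_nonneg]; exact_mod_cast hab
  have h2 := norm_sum_indicator_fract_lt_sub_le (J := Finset.Ico a b) (t := t)
    (A := 10 * (α * ((b : ℝ) - a) * √lam)) (B := 10 * (1 / √lam)) (by positivity) (by positivity)
    hδ hδ1 (norm_sum_expi_twist_le hσ hpos hα hab
      (fun n h1 h2 => hlam n (by omega) (by omega)) (fun n h1 h2 => hup n (by omega) (by omega)))
    hu0 hu1 η
  refine h2.trans ?_
  have := zetaThreeHalves_nonneg
  rw [Nat.card_Ico, Nat.cast_sub hab]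
  gcongr

end Blocks

/-! ### Dyadic ranges and the choice of block length and smoothing. -/

section Powers

lemma rpow_le_four_mul_rpow {x y e : ℝ} (hy : 0 < y) (h1 : y / 2 ≤ x) (h2 : x ≤ 2 * y)
    (he : |e| ≤ 2) : x ^ e ≤ 4 * y ^ e := by
  have hx : 0 < x := by linarith
  have he' := abs_le.1 he
  have : (x / y) ^ e ≤ 4 := by
    rcases le_total 0 e with h | h
    · calc (x / y) ^ e ≤ 2 ^ e :=
            Real.rpow_le_rpow (by positivity) (by rw [div_le_iff₀ hy]; exact h2) h
        _ ≤ 2 ^ (2 : ℝ) := Real.rpow_le_rpow_of_exponent_le (by norm_num) he'.2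
        _ = 4 := by norm_num
    · calc (x / y) ^ e ≤ (1 / 2) ^ e :=
            Real.rpow_le_rpow_of_nonpos (by norm_num)
              (by rw [le_div_iff₀ hy]; linarith) h
        _ = 2 ^ (-e) := by rw [one_div, Real.inv_rpow (by norm_num), Real.rpow_neg (by norm_num)]
        _ ≤ 2 ^ (2 : ℝ) := Real.rpow_le_rpow_of_exponent_le (by norm_num) (by linarith)
        _ = 4 := by norm_num
  rw [Real.div_rpow hx.le hy.le, div_le_iff₀ (by positivity)] at this
  exact this

end Powers

/-- The twisted sums of the weights over dyadic blocks, for weights and second differences of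
power size up to a small power. -/
lemma exists_norm_sum_dyadic_le {t v : ℕ → ℝ} {g₁ g₂ χ ε σ : ℝ} {N₀ : ℕ}
    (hσ : σ = 1 ∨ σ = -1) (hg₂ : g₂ ≤ 1)
    (hχ : 0 ≤ χ) (hε : 0 < ε)
    (hc₁ : 2 * χ + 5 * ε ≤ 2 * g₂ - 1 - g₁ / 2) (hc₂ : 2 * χ + 5 * ε ≤ g₁ / 2 + g₂ - 1)
    (hlam : ∀ n, N₀ ≤ n → (n : ℝ) ^ (g₁ - 2 - ε)
      ≤ σ * ((t (n + 2) - t (n + 1)) - (t (n + 1) - t n)))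
    (hup : ∀ n, N₀ ≤ n → σ * ((t (n + 2) - t (n + 1)) - (t (n + 1) - t n))
      ≤ (n : ℝ) ^ (g₁ - 2 + ε))
    (hv : ∀ m n, N₀ ≤ m → m ≤ n → v n ≤ v m) (hv0 : ∀ n, N₀ ≤ n → 0 < v n ∧ v n ≤ 1)
    (hvl : ∀ n, N₀ ≤ n → (n : ℝ) ^ (g₂ - 1 - ε) ≤ v n)
    (hvu : ∀ n, N₀ ≤ n → v n ≤ (n : ℝ) ^ (g₂ - 1 + ε)) :
    ∃ C : ℝ, 0 < C ∧ ∀ N : ℕ, 2 * N₀ + 2 ≤ N → ∀ ξ : ℝ,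
      ‖∑ n ∈ Finset.Ico (N / 2 + 1) (N + 1),
        (((if Int.fract (t n) < v n then (v n)⁻¹ else 0) - 1 : ℝ) : ℂ) * expi (n * ξ)‖
      ≤ C * (N : ℝ) ^ (1 - χ) := by
  have hZ := zetaThreeHalves_nonneg
  refine ⟨64 + 12 * (4 * (6 * (10 * 16 * zetaThreeHalves))
    + 2 * (6 * (10 * 2 * zetaThreeHalves)) + 16), by positivity, fun N hN ξ => ?_⟩
  set X : ℝ := (N : ℝ) with hX
  have hX1 : 1 ≤ X := by rw [hX]; exact_mod_cast (by omega : 1 ≤ N)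
  have hX0 : 0 < X := by linarith
  set A := N / 2 + 1 with hA
  set B := N + 1 with hB
  have hAX : X / 2 ≤ A := by
    have : (N : ℝ) ≤ 2 * A := by exact_mod_cast (by omega : N ≤ 2 * A)
    rw [hX]; linarith
  have hBX : (B : ℝ) ≤ 2 * X := by rw [hX]; exact_mod_cast (by omega : B ≤ 2 * N)
  have hABr : (A : ℝ) ≤ B := by exact_mod_cast (by omega : A ≤ B)
  have hBA : (B : ℝ) - A ≤ X := by
    rw [sub_le_iff_le_add, hX]; exact_mod_cast (by omega : B ≤ N + A)
  have hin : ∀ n : ℕ, A ≤ n → n ≤ B → X / 2 ≤ n ∧ (n : ℝ) ≤ 2 * X := by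
    intro n h1 h2
    have h3 : (A : ℝ) ≤ n := by exact_mod_cast h1
    have h4 : (n : ℝ) ≤ B := by exact_mod_cast h2
    exact ⟨by linarith, by linarith⟩
  have hup4 : ∀ e : ℝ, |e| ≤ 2 → ∀ n : ℕ, A ≤ n → n ≤ B → (n : ℝ) ^ e ≤ 4 * X ^ e :=
    fun e he n h1 h2 => rpow_le_four_mul_rpow hX0 (hin n h1 h2).1 (hin n h1 h2).2 he
  have hlo4 : ∀ e : ℝ, |e| ≤ 2 → ∀ n : ℕ, A ≤ n → n ≤ B → X ^ e / 4 ≤ (n : ℝ) ^ e := by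
    intro e he n h1 h2
    have h3 := hin n h1 h2
    have := rpow_le_four_mul_rpow (x := X) (y := n) (e := e) (by linarith) (by linarith)
      (by linarith) he
    linarith
  -- The block length `X^η` makes the freezing error `H * (v A / v B)`, which loses `X^(2ε)`,
  -- acceptable; the smoothing `δ = X^(-κ)` makes `δ X / v B` acceptable. The two van der Corput
  -- terms then fit by `hc₁` and `hc₂` respectively.
  set η := 1 - χ - 3 * ε with hη
  set κ := 1 - g₂ + χ + 2 * ε with hκ
  set H := ⌈X ^ η⌉₊ with hH
  have hXη : 1 ≤ X ^ η := Real.one_le_rpow hX1 (by linarith)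
  have hH1 : X ^ η ≤ H := Nat.le_ceil _
  have hH2 : (H : ℝ) ≤ 2 * X ^ η := by
    have := Nat.ceil_lt_add_one (zero_le_one.trans hXη)
    linarith
  have hH0 : 1 ≤ H := by
    have : (1 : ℝ) ≤ H := hXη.trans hH1
    exact_mod_cast this
  have hδ0 : 0 < X ^ (-κ) := by positivity
  have hδ1 : X ^ (-κ) ≤ 1 := Real.rpow_le_one_of_one_le_of_nonpos hX1 (by linarith)
  -- All indices lie in `[X/2, 2X]`, where powers with exponent in `[-2, 2]` vary by a factor at
  -- most `4`; hence the `4` in `lam` and the `16` in `α`.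
  have main := norm_sum_weight_le_of_second_difference (t := t) (v := v) (A := A) (B := B) (H := H)
    (lam := X ^ (g₁ - 2 - ε) / 4) (α := 16 * X ^ (2 * ε)) (σ := σ) (δ := X ^ (-κ)) hσ
    (by positivity) (by linarith [Real.one_le_rpow hX1 (by linarith : 0 ≤ 2 * ε)])
    (by omega) hH0 hδ0 hδ1
    (fun n h1 h2 => (hlo4 _ (abs_le.2 ⟨by linarith, by linarith⟩) n h1 h2.le).trans
      (hlam n (by omega)))
    (fun n h1 h2 => by
      refine ((hup n (by omega)).trans
        (hup4 _ (abs_le.2 ⟨by linarith, by linarith⟩) n h1 h2.le)).trans (le_of_eq ?_)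
      rw [show g₁ - 2 + ε = 2 * ε + (g₁ - 2 - ε) by ring, Real.rpow_add hX0]
      ring)
    (fun m n h1 h2 h3 => hv m n (by omega) h2) (hv0 B (by omega)).1 (hv0 A (by omega)).2 ξ
  refine main.trans ?_
  have hvB : X ^ (g₂ - 1 - ε) / 4 ≤ v B :=
    (hlo4 _ (abs_le.2 ⟨by linarith, by linarith⟩) B (by omega) le_rfl).trans (hvl B (by omega))
  have hvA : v A ≤ 4 * X ^ (g₂ - 1 + ε) :=
    (hvu A (by omega)).trans (hup4 _ (abs_le.2 ⟨by linarith, by linarith⟩) A le_rfl (by omega))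
  have hvB' : 1 / v B ≤ 4 * X ^ (1 - g₂ + ε) := by
    rw [div_le_iff₀ (hv0 B (by omega)).1]
    have e : 1 = 4 * X ^ (1 - g₂ + ε) * (X ^ (g₂ - 1 - ε) / 4) := by
      rw [show 4 * X ^ (1 - g₂ + ε) * (X ^ (g₂ - 1 - ε) / 4)
        = X ^ (1 - g₂ + ε) * X ^ (g₂ - 1 - ε) by ring, ← Real.rpow_add hX0]
      rw [show 1 - g₂ + ε + (g₂ - 1 - ε) = 0 by ring, Real.rpow_zero]
    calc (1 : ℝ) = 4 * X ^ (1 - g₂ + ε) * (X ^ (g₂ - 1 - ε) / 4) := e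
      _ ≤ _ := by gcongr
  have hsq : √(X ^ (g₁ - 2 - ε) / 4) = X ^ ((g₁ - 2 - ε) / 2) / 2 := by
    rw [Real.sqrt_eq_iff_mul_self_eq (by positivity) (by positivity)]
    rw [div_mul_div_comm, ← Real.rpow_add hX0]
    norm_num
  have hK : ((B : ℝ) - A) / H + 1 ≤ 2 * X ^ (1 - η) := by
    have h1 : ((B : ℝ) - A) / H ≤ X ^ (1 - η) := by
      rw [Real.rpow_sub hX0, Real.rpow_one]
      gcongr
    have h2 : 1 ≤ X ^ (1 - η) := Real.one_le_rpow hX1 (by linarith)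
    linarith
  have hvB0 := (hv0 B (by omega)).1
  have hvA0 := (hv0 A (by omega)).1
  -- every term is bounded by a multiple of one power
  have hpow : ∀ e : ℝ, e ≤ 1 - χ → X ^ e ≤ X ^ (1 - χ) :=
    fun e he => Real.rpow_le_rpow_of_exponent_le hX1 he
  have T1 : 2 * H * (v A / v B) ≤ 64 * X ^ (1 - χ) := by
    calc 2 * H * (v A / v B) = 2 * H * (v A * (1 / v B)) := by ring
      _ ≤ 2 * (2 * X ^ η) * (4 * X ^ (g₂ - 1 + ε) * (4 * X ^ (1 - g₂ + ε))) := by gcongr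
      _ = 64 * (X ^ η * X ^ (g₂ - 1 + ε) * X ^ (1 - g₂ + ε)) := by ring
      _ = 64 * X ^ (η + (g₂ - 1 + ε) + (1 - g₂ + ε)) := by
        rw [Real.rpow_add hX0 (η + (g₂ - 1 + ε)), Real.rpow_add hX0 η]
      _ ≤ _ := by gcongr 64 * ?_; exact hpow _ (by linarith)
  have hKH : (((B : ℝ) - A) / H + 1) * H ≤ 4 * X := by
    calc (((B : ℝ) - A) / H + 1) * H ≤ (2 * X ^ (1 - η)) * (2 * X ^ η) := by gcongr
      _ = 4 * (X ^ (1 - η) * X ^ η) := by ring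
      _ = 4 * X := by rw [← Real.rpow_add hX0, sub_add_cancel, Real.rpow_one]
  have P1 : X ^ (1 - g₂ + ε) * (X * (X ^ (2 * ε) * X ^ ((g₁ - 2 - ε) / 2) * X ^ κ))
      ≤ X ^ (1 - χ) := by
    nth_rewrite 2 [← Real.rpow_one X]
    rw [← Real.rpow_add hX0, ← Real.rpow_add hX0, ← Real.rpow_add hX0, ← Real.rpow_add hX0]
    exact hpow _ (by linarith)
  have P2 : X ^ (1 - g₂ + ε) * (X ^ (1 - η) * X ^ (-((g₁ - 2 - ε) / 2))) ≤ X ^ (1 - χ) := by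
    rw [← Real.rpow_add hX0, ← Real.rpow_add hX0]
    exact hpow _ (by linarith)
  have P3 : X ^ (1 - g₂ + ε) * (X * X ^ (-κ)) ≤ X ^ (1 - χ) := by
    nth_rewrite 2 [← Real.rpow_one X]
    rw [← Real.rpow_add hX0, ← Real.rpow_add hX0]
    exact hpow _ (by linarith)
  have T2 : 3 * (((B : ℝ) - A) / H + 1)
        * (6 * ((10 * (16 * X ^ (2 * ε) * H * √(X ^ (g₁ - 2 - ε) / 4)) / X ^ (-κ)
          + 10 * (1 / √(X ^ (g₁ - 2 - ε) / 4))) * zetaThreeHalves) + 4 * X ^ (-κ) * H) / v B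
      ≤ 12 * (4 * (6 * (10 * 16 * zetaThreeHalves))
    + 2 * (6 * (10 * 2 * zetaThreeHalves)) + 16) * X ^ (1 - χ) := by
    rw [hsq]
    set K := ((B : ℝ) - A) / H + 1 with hKdef
    have hK0 : 0 ≤ K := by
      have : 0 ≤ (B : ℝ) - A := by linarith
      positivity
    set R := X ^ ((g₁ - 2 - ε) / 2) with hR
    have hRinv : 1 / (R / 2) = 2 * X ^ (-((g₁ - 2 - ε) / 2)) := by
      rw [Real.rpow_neg hX0.le, ← hR]; field_simp
    have hκinv : X ^ κ = 1 / X ^ (-κ) := by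
      rw [Real.rpow_neg hX0.le]; field_simp
    calc _ = 3 * (1 / v B) * (6 * (10 * 8 * zetaThreeHalves) *
              ((K * H) * (X ^ (2 * ε) * R * X ^ κ))
            + 6 * (10 * zetaThreeHalves) * (K * (1 / (R / 2))) + 4 * ((K * H) * X ^ (-κ))) := by
          rw [hκinv]; ring
      _ ≤ 3 * (4 * X ^ (1 - g₂ + ε)) * (6 * (10 * 8 * zetaThreeHalves) *
              ((4 * X) * (X ^ (2 * ε) * R * X ^ κ))
            + 6 * (10 * zetaThreeHalves) * ((2 * X ^ (1 - η)) * (1 / (R / 2)))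
            + 4 * ((4 * X) * X ^ (-κ))) := by gcongr
      _ = 12 * (4 * (6 * (10 * 8 * zetaThreeHalves)) * (X ^ (1 - g₂ + ε) *
              (X * (X ^ (2 * ε) * R * X ^ κ)))
            + 2 * (6 * (10 * 2 * zetaThreeHalves)) * (X ^ (1 - g₂ + ε) *
              (X ^ (1 - η) * X ^ (-((g₁ - 2 - ε) / 2))))
            + 16 * (X ^ (1 - g₂ + ε) * (X * X ^ (-κ)))) := by
          rw [hRinv]; ring
      _ ≤ 12 * (4 * (6 * (10 * 16 * zetaThreeHalves)) * X ^ (1 - χ)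
            + 2 * (6 * (10 * 2 * zetaThreeHalves)) * X ^ (1 - χ) + 16 * X ^ (1 - χ)) := by
          gcongr; norm_num
      _ = _ := by ring
  linarith

/-- Summation of dyadic bounds. -/
lemma exists_norm_sum_le_of_dyadic {w : ℕ → ℂ} {χ C : ℝ} {N₀ : ℕ} (hχ : χ ≤ 1 / 2) (hC : 0 < C)
    (h : ∀ N : ℕ, N₀ ≤ N → ∀ ξ : ℝ,
      ‖∑ n ∈ Finset.Ico (N / 2 + 1) (N + 1), w n * expi (n * ξ)‖ ≤ C * (N : ℝ) ^ (1 - χ)) :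
    ∃ C' : ℝ, 0 < C' ∧ ∀ N : ℕ, 1 ≤ N → ∀ ξ : ℝ,
      ‖∑ n ∈ Finset.Ico 1 (N + 1), w n * expi (n * ξ)‖ ≤ C' * (N : ℝ) ^ (1 - χ) := by
  set M := ∑ n ∈ Finset.Ico 1 (N₀ + 2), ‖w n‖ with hM
  have hM0 : 0 ≤ M := Finset.sum_nonneg fun _ _ => norm_nonneg _
  refine ⟨4 * C + M, by positivity, fun N => ?_⟩
  induction N using Nat.strong_induction_on with
  | _ N ih =>
  intro hN ξ
  have hX1 : (1 : ℝ) ≤ N := by exact_mod_cast hN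
  have hX : 1 ≤ (N : ℝ) ^ (1 - χ) := Real.one_le_rpow hX1 (by linarith)
  rcases lt_or_ge N (N₀ + 2) with h1 | h1
  · have h2 : ‖∑ n ∈ Finset.Ico 1 (N + 1), w n * expi (n * ξ)‖ ≤ M := by
      refine (norm_sum_le _ _).trans ?_
      simp_rw [norm_mul, norm_expi, mul_one]
      exact Finset.sum_le_sum_of_subset_of_nonneg
        (Finset.Ico_subset_Ico le_rfl (by omega)) fun _ _ _ => norm_nonneg _
    nlinarith
  · rw [← Finset.sum_Ico_consecutive _ (by omega : 1 ≤ N / 2 + 1) (by omega : N / 2 + 1 ≤ N + 1)]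
    refine (norm_add_le _ _).trans ?_
    have h2 := ih (N / 2) (by omega) (by omega) ξ
    have h3 := h N (by omega) ξ
    -- Here `χ ≤ 1/2` gives the ratio `2^(-1/2) ≤ 3/4`, and the constant `4 * C` is the one with
    -- `3/4 * (4 * C) + C = 4 * C`.
    have h4 : ((N / 2 : ℕ) : ℝ) ^ (1 - χ) ≤ 3 / 4 * (N : ℝ) ^ (1 - χ) := by
      have h5 : ((N / 2 : ℕ) : ℝ) ≤ (1 / 2) * (N : ℝ) := by
        have := Nat.cast_div_le (α := ℝ) (m := N) (n := 2)
        push_cast at this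
        linarith
      calc ((N / 2 : ℕ) : ℝ) ^ (1 - χ) ≤ ((1 / 2) * (N : ℝ)) ^ (1 - χ) :=
            Real.rpow_le_rpow (by positivity) h5 (by linarith)
        _ = (1 / 2 : ℝ) ^ (1 - χ) * (N : ℝ) ^ (1 - χ) :=
            Real.mul_rpow (by norm_num) (by positivity)
        _ ≤ 3 / 4 * (N : ℝ) ^ (1 - χ) := by
          gcongr
          calc (1 / 2 : ℝ) ^ (1 - χ) ≤ (1 / 2 : ℝ) ^ (1 / 2 : ℝ) :=
                Real.rpow_le_rpow_of_exponent_ge (by norm_num) (by norm_num) (by linarith)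
            _ = √(1 / 2) := (Real.sqrt_eq_rpow _).symm
            _ ≤ 3 / 4 := by rw [Real.sqrt_le_left (by norm_num)]; norm_num
    have h6 : (4 * C + M) * ((N / 2 : ℕ) : ℝ) ^ (1 - χ)
        ≤ (4 * C + M) * (3 / 4 * (N : ℝ) ^ (1 - χ)) := by gcongr
    nlinarith

/-! ### The Tomas–Stein argument on level sets. -/

section Restriction

lemma volume_eq_haarAddCircle :
    (volume : Measure UnitAddCircle) = AddCircle.haarAddCircle := by
  rw [AddCircle.volume_eq_smul_haarAddCircle]; simp

instance : IsProbabilityMeasure (volume : Measure UnitAddCircle) := by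
  rw [volume_eq_haarAddCircle]; infer_instance

lemma norm_fourier_apply (n : ℤ) (x : UnitAddCircle) : ‖fourier n x‖ = 1 := by
  rw [fourier_apply]; exact Circle.norm_coe _

lemma fourier_apply_sub (n : ℤ) (x y : UnitAddCircle) :
    fourier n (x - y) = fourier n x * (starRingEnd ℂ) (fourier n y) := by
  rw [← fourier_neg]
  simp only [fourier_apply, smul_add, smul_neg, neg_smul, sub_eq_add_neg, AddCircle.toCircle_add,
    Circle.coe_mul]

lemma fourier_coe_eq_expi (n : ℤ) (x : ℝ) : fourier n (x : UnitAddCircle) = expi (n * x) := by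
  rw [fourier_coe_apply, expi]; congr 1; push_cast; ring

variable {g : UnitAddCircle → ℂ} {a : ℝ}

/-- The Fourier integral `∫ g(ξ) e^{2πinξ} dξ`. -/
noncomputable def fourierInt (g : UnitAddCircle → ℂ) (n : ℤ) : ℂ := ∫ ξ, g ξ * fourier n ξ

lemma integrable_mul_fourier (hg : Integrable g) (n : ℤ) :
    Integrable (fun ξ => g ξ * fourier n ξ) :=
  hg.mul_bdd (c := 1) (fourier n).continuous.aestronglyMeasurable
    (ae_of_all _ fun x => (norm_fourier_apply n x).le)

lemma norm_fourierInt_le (n : ℤ) : ‖fourierInt g n‖ ≤ ∫ ξ, ‖g ξ‖ := by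
  refine (norm_integral_le_integral_norm _).trans (le_of_eq ?_)
  simp_rw [norm_mul, norm_fourier_apply, mul_one]

lemma sum_norm_fourierInt_sq_le (S : Finset ℤ) (hg : MemLp g 2) :
    ∑ n ∈ S, ‖fourierInt g n‖ ^ 2 ≤ ∫ ξ, ‖g ξ‖ ^ 2 := by
  have hg' := hg.haarAddCircle
  have h := hasSum_sq_fourierCoeff hg'.toLp
  -- `fourierCoeff` integrates against the conjugate character, hence the sign.
  have e1 : ∀ n, fourierInt g n = fourierCoeff hg'.toLp (-n) := by
    intro n
    rw [fourierCoeff_congr_ae hg'.coeFn_toLp, fourierCoeff, fourierInt, volume_eq_haarAddCircle]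
    simp_rw [neg_neg, smul_eq_mul, mul_comm]
  have e2 : ∫ t, ‖hg'.toLp g t‖ ^ 2 ∂AddCircle.haarAddCircle = ∫ ξ, ‖g ξ‖ ^ 2 := by
    rw [volume_eq_haarAddCircle]
    refine integral_congr_ae ?_
    filter_upwards [hg'.coeFn_toLp] with x hx
    rw [hx]
  rw [e2] at h
  simp_rw [e1]
  have h2 := sum_le_hasSum (S.map (Equiv.neg ℤ).toEmbedding) (fun _ _ => by positivity) h
  rwa [Finset.sum_map] at h2

/-- The quadratic form is the double integral of `g(ξ) conj(g(η)) k(ξ - η)` with `k = ∑ d_n e(n·)`,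
so a sup bound for `k` gives an `L¹` bound. -/
lemma abs_sum_mul_norm_fourierInt_sq_le (S : Finset ℤ) (d : ℤ → ℝ) {E : ℝ} (hg : Integrable g)
    (hE : ∀ ξ : UnitAddCircle, ‖∑ n ∈ S, (d n : ℂ) * fourier n ξ‖ ≤ E) :
    |∑ n ∈ S, d n * ‖fourierInt g n‖ ^ 2| ≤ E * (∫ ξ, ‖g ξ‖) ^ 2 := by
  have hconj : ∀ n, (starRingEnd ℂ) (fourierInt g n)
      = ∫ η, (starRingEnd ℂ) (g η) * (starRingEnd ℂ) (fourier n η) := by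
    intro n
    rw [fourierInt, ← integral_conj]
    simp_rw [map_mul]
  have hgc : Integrable (fun η => (starRingEnd ℂ) (g η)) := by
    refine hg.congr' ?_ (ae_of_all _ fun x => (RCLike.norm_conj _).symm)
    exact Complex.continuous_conj.comp_aestronglyMeasurable hg.1
  have hinner : ∀ ξ : UnitAddCircle,
      ‖∑ n ∈ S, (d n : ℂ) * (starRingEnd ℂ) (fourierInt g n) * fourier n ξ‖
        ≤ E * ∫ η, ‖g η‖ := by
    intro ξ
    have e : ∑ n ∈ S, (d n : ℂ) * (starRingEnd ℂ) (fourierInt g n) * fourier n ξ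
        = ∫ η, (starRingEnd ℂ) (g η) * ∑ n ∈ S, (d n : ℂ) * fourier n (ξ - η) := by
      simp_rw [Finset.mul_sum]
      rw [integral_finsetSum]
      · refine Finset.sum_congr rfl fun n _ => ?_
        rw [hconj, mul_right_comm, ← integral_const_mul]
        refine integral_congr_ae (ae_of_all _ fun η => ?_)
        simp only [fourier_apply_sub]
        ring
      · intro n _
        refine hgc.mul_bdd (c := |d n|) (Continuous.aestronglyMeasurable ?_) (ae_of_all _ fun η => ?_)
        · exact continuous_const.mul ((fourier n).continuous.comp (continuous_const.sub continuous_id))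
        · rw [norm_mul, norm_fourier_apply, mul_one, Complex.norm_real, Real.norm_eq_abs]
    rw [e, ← integral_const_mul]
    refine norm_integral_le_of_norm_le (hg.norm.const_mul E) (ae_of_all _ fun η => ?_)
    rw [norm_mul, RCLike.norm_conj, mul_comm]
    exact mul_le_mul_of_nonneg_right (hE _) (norm_nonneg _)
  have e : ((∑ n ∈ S, d n * ‖fourierInt g n‖ ^ 2 : ℝ) : ℂ)
      = ∫ ξ, g ξ * ∑ n ∈ S, (d n : ℂ) * (starRingEnd ℂ) (fourierInt g n) * fourier n ξ := by
    simp_rw [Finset.mul_sum]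
    rw [integral_finsetSum]
    · push_cast
      refine Finset.sum_congr rfl fun n _ => ?_
      rw [← Complex.conj_mul']
      nth_rewrite 2 [fourierInt]
      rw [← mul_assoc, ← integral_const_mul]
      refine integral_congr_ae (ae_of_all _ fun ξ => ?_)
      simp only
      ring
    · intro n _
      refine ((integrable_mul_fourier hg n).const_mul
        ((d n : ℂ) * (starRingEnd ℂ) (fourierInt g n))).congr (ae_of_all _ fun ξ => ?_)
      simp only
      ring
  rw [← Real.norm_eq_abs, ← Complex.norm_real, e, pow_two, ← mul_assoc, ← integral_const_mul]
  refine norm_integral_le_of_norm_le (hg.norm.const_mul _) (ae_of_all _ fun ξ => ?_)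
  rw [norm_mul, mul_comm]
  exact mul_le_mul_of_nonneg_right (hinner ξ) (norm_nonneg _)

lemma le_rpow_mul_rpow {x u v θ : ℝ} (hx : 0 ≤ x) (hu : x ≤ u) (hv : x ≤ v) (h0 : 0 ≤ θ)
    (h1 : θ ≤ 1) : x ≤ u ^ θ * v ^ (1 - θ) := by
  calc x = x ^ θ * x ^ (1 - θ) := by
        rw [← Real.rpow_add_of_nonneg hx h0 (by linarith), add_sub_cancel, Real.rpow_one]
    _ ≤ u ^ θ * v ^ (1 - θ) := by
        have : 0 ≤ 1 - θ := by linarith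
        have : 0 ≤ u := hx.trans hu
        gcongr

/-- The dual form of the restriction estimate on functions bounded by an indicator function. -/
lemma sum_weight_mul_norm_fourierInt_sq_le {S : Finset ℤ} {w : ℤ → ℝ} {N : ℕ} {D E K θ : ℝ}
    (hN : 1 ≤ N) (hS : S.card = N) (hD : ∀ n ∈ S, |w n - (N : ℝ)⁻¹| ≤ D)
    (hE : ∀ ξ : UnitAddCircle, ‖∑ n ∈ S, ((w n - (N : ℝ)⁻¹ : ℝ) : ℂ) * fourier n ξ‖ ≤ E)
    (hD0 : 0 ≤ D) (h0 : 0 ≤ θ) (h1 : θ ≤ 1) (hK : D ^ θ * E ^ (1 - θ) ≤ K * (N : ℝ) ^ (-θ))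
    (hg : MemLp g 2) (ha : 0 < a) (hg1 : ∫ ξ, ‖g ξ‖ ≤ a) (hg2 : ∫ ξ, ‖g ξ‖ ^ 2 ≤ a) :
    ∑ n ∈ S, w n * ‖fourierInt g n‖ ^ 2 ≤ (1 + K) * ((N : ℝ) ^ (-θ) * a ^ (2 - θ)) := by
  have hN0 : (0 : ℝ) < N := by exact_mod_cast hN
  have hE0 : 0 ≤ E := (norm_nonneg _).trans (hE 0)
  have hbes := (sum_norm_fourierInt_sq_le S hg).trans hg2
  have hgi : Integrable g := hg.integrable one_le_two
  have hI0 : 0 ≤ ∫ ξ, ‖g ξ‖ := integral_nonneg fun _ => norm_nonneg _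
  have hpt : ∀ n, ‖fourierInt g n‖ ^ 2 ≤ a ^ 2 := fun n => by
    have := (norm_fourierInt_le n (g := g)).trans hg1
    gcongr
  have hsplit : ∑ n ∈ S, w n * ‖fourierInt g n‖ ^ 2
      = (N : ℝ)⁻¹ * ∑ n ∈ S, ‖fourierInt g n‖ ^ 2
        + ∑ n ∈ S, (w n - (N : ℝ)⁻¹) * ‖fourierInt g n‖ ^ 2 := by
    rw [Finset.mul_sum, ← Finset.sum_add_distrib]
    exact Finset.sum_congr rfl fun n _ => by ring
  have haθ : ∀ x y : ℝ, 0 ≤ x → 0 ≤ y →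
      (x * a) ^ θ * (y * a ^ 2) ^ (1 - θ) = x ^ θ * y ^ (1 - θ) * a ^ (2 - θ) := by
    intro x y hx hy
    rw [Real.mul_rpow hx ha.le, Real.mul_rpow hy (by positivity), ← Real.rpow_natCast_mul ha.le,
      show (2 - θ) = θ + ((2 : ℕ) : ℝ) * (1 - θ) by push_cast; ring, Real.rpow_add ha]
    ring
  -- Uniform part: the geometric mean of Bessel's `a / N` and of `a²`, which comes from `|ĝ| ≤ a` at
  -- each of the `N` points.
  have b1 : (N : ℝ)⁻¹ * ∑ n ∈ S, ‖fourierInt g n‖ ^ 2 ≤ (N : ℝ) ^ (-θ) * a ^ (2 - θ) := by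
    have h2 : (N : ℝ)⁻¹ * ∑ n ∈ S, ‖fourierInt g n‖ ^ 2 ≤ 1 * a ^ 2 := by
      have := Finset.sum_le_sum fun n (_ : n ∈ S) => hpt n
      rw [Finset.sum_const, nsmul_eq_mul, hS] at this
      rw [inv_mul_le_iff₀ hN0, one_mul]
      exact this
    have h3 : (N : ℝ)⁻¹ * ∑ n ∈ S, ‖fourierInt g n‖ ^ 2 ≤ (N : ℝ)⁻¹ * a := by gcongr
    refine (le_rpow_mul_rpow (by positivity) h3 h2 h0 h1).trans (le_of_eq ?_)
    rw [haθ _ _ (by positivity) zero_le_one, Real.one_rpow, mul_one, Real.inv_rpow hN0.le,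
      Real.rpow_neg hN0.le]
  -- Difference: Bessel with the largest coefficient gives `D * a`, the kernel bound gives `E * a ^
  -- 2`.
  have b2 : |∑ n ∈ S, (w n - (N : ℝ)⁻¹) * ‖fourierInt g n‖ ^ 2|
      ≤ K * ((N : ℝ) ^ (-θ) * a ^ (2 - θ)) := by
    have h2 : |∑ n ∈ S, (w n - (N : ℝ)⁻¹) * ‖fourierInt g n‖ ^ 2| ≤ E * a ^ 2 :=
      (abs_sum_mul_norm_fourierInt_sq_le S _ hgi hE).trans (by gcongr)
    have h3 : |∑ n ∈ S, (w n - (N : ℝ)⁻¹) * ‖fourierInt g n‖ ^ 2| ≤ D * a := by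
      refine (Finset.abs_sum_le_sum_abs _ _).trans ?_
      calc ∑ n ∈ S, |(w n - (N : ℝ)⁻¹) * ‖fourierInt g n‖ ^ 2|
          ≤ ∑ n ∈ S, D * ‖fourierInt g n‖ ^ 2 := by
            refine Finset.sum_le_sum fun n hn => ?_
            rw [abs_mul, abs_of_nonneg (sq_nonneg ‖fourierInt g n‖)]
            exact mul_le_mul_of_nonneg_right (hD n hn) (sq_nonneg _)
        _ = D * ∑ n ∈ S, ‖fourierInt g n‖ ^ 2 := (Finset.mul_sum _ _ _).symm
        _ ≤ D * a := by gcongr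
    refine (le_rpow_mul_rpow (abs_nonneg _) h3 h2 h0 h1).trans ?_
    rw [haθ _ _ hD0 hE0, ← mul_assoc]
    gcongr
  rw [hsplit, add_mul, one_mul]
  exact add_le_add b1 ((le_abs_self _).trans b2)

variable {S : Finset ℤ} {w : ℤ → ℝ} {f : ℤ → ℂ}

/-- The trigonometric polynomial with coefficients `f n * w n`. -/
noncomputable def trigPoly (S : Finset ℤ) (w : ℤ → ℝ) (f : ℤ → ℂ) (ξ : UnitAddCircle) : ℂ :=
  ∑ n ∈ S, f n * (w n : ℂ) * fourier n ξ

lemma continuous_trigPoly : Continuous (trigPoly S w f) :=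
  continuous_finsetSum _ fun n _ => continuous_const.mul (fourier n).continuous

/-- Cauchy–Schwarz for the weight `w`. It serves with `z` a Fourier integral (duality) and with `z`
a character (sup bound). -/
lemma norm_sum_mul_weight_sq_le (hw : ∀ n ∈ S, 0 ≤ w n) (z : ℤ → ℂ) :
    ‖∑ n ∈ S, f n * (w n : ℂ) * z n‖ ^ 2
      ≤ (∑ n ∈ S, ‖f n‖ ^ 2 * w n) * ∑ n ∈ S, w n * ‖z n‖ ^ 2 := by
  have h1 : ‖∑ n ∈ S, f n * (w n : ℂ) * z n‖ ≤ ∑ n ∈ S, (‖f n‖ * √(w n)) * (√(w n) * ‖z n‖) := by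
    refine norm_sum_le_of_le _ fun n hn => le_of_eq ?_
    rw [norm_mul, norm_mul, Complex.norm_real, Real.norm_eq_abs, abs_of_nonneg (hw n hn)]
    nth_rewrite 1 [← Real.mul_self_sqrt (hw n hn)]
    ring
  refine (pow_le_pow_left₀ (norm_nonneg _) h1 2).trans ?_
  refine (Finset.sum_mul_sq_le_sq_mul_sq S _ _).trans (le_of_eq ?_)
  congr 1 <;> refine Finset.sum_congr rfl fun n hn => ?_ <;> rw [mul_pow, Real.sq_sqrt (hw n hn)]

/-- The weak type estimate for the level sets of a trigonometric polynomial. -/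
lemma volume_level_le {N : ℕ} {D E K q lam : ℝ} (hq : 2 < q) (hlam : 0 < lam)
    (hN : 1 ≤ N) (hS : S.card = N) (hw : ∀ n ∈ S, 0 ≤ w n)
    (hD0 : 0 ≤ D) (hD : ∀ n ∈ S, |w n - (N : ℝ)⁻¹| ≤ D)
    (hE : ∀ ξ : UnitAddCircle, ‖∑ n ∈ S, ((w n - (N : ℝ)⁻¹ : ℝ) : ℂ) * fourier n ξ‖ ≤ E)
    (hK0 : 0 ≤ K) (hK : D ^ (2 / q) * E ^ (1 - 2 / q) ≤ K * (N : ℝ) ^ (-(2 / q))) :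
    volume.real {ξ | lam < ‖trigPoly S w f ξ‖}
      ≤ (√((1 + K) * ∑ n ∈ S, ‖f n‖ ^ 2 * w n) / lam) ^ q / N := by
  set A := {ξ | lam < ‖trigPoly S w f ξ‖} with hA
  have hAm : MeasurableSet A :=
    (isOpen_lt continuous_const continuous_trigPoly.norm).measurableSet
  set P := ∑ n ∈ S, ‖f n‖ ^ 2 * w n with hP
  have hP0 : 0 ≤ P := Finset.sum_nonneg fun n hn => mul_nonneg (sq_nonneg _) (hw n hn)
  have hN0 : (0 : ℝ) < N := by exact_mod_cast hN
  set a := volume.real A with ha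
  -- A null level set is set aside, since a power of its measure is cancelled below.
  rcases (measureReal_nonneg (μ := volume) (s := A)).eq_or_lt with ha0 | ha0
  · rw [ha, ← ha0]; positivity
  set F := trigPoly S w f with hF
  -- This test function turns `∫ g F` into the integral of `|F|` over the level set, which is at
  -- least `lam * a`.
  set g : UnitAddCircle → ℂ := A.indicator fun ξ => (starRingEnd ℂ) (F ξ) / (‖F ξ‖ : ℂ) with hg
  have hFm : Measurable F := continuous_trigPoly.measurable
  have hgm : Measurable g := by
    refine Measurable.indicator ?_ hAm
    exact (Complex.continuous_conj.measurable.comp hFm).div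
      (Complex.measurable_ofReal.comp hFm.norm)
  have hgn : ∀ ξ, ‖g ξ‖ = A.indicator (fun _ => (1 : ℝ)) ξ := by
    intro ξ
    by_cases hξ : ξ ∈ A
    · have : 0 < ‖F ξ‖ := hlam.trans hξ
      rw [hg, Set.indicator_of_mem hξ, Set.indicator_of_mem hξ, norm_div, RCLike.norm_conj,
        Complex.norm_real, norm_norm, div_self this.ne']
    · rw [hg, Set.indicator_of_notMem hξ, Set.indicator_of_notMem hξ, norm_zero]
  have hgsq : ∀ ξ, ‖g ξ‖ ^ 2 = A.indicator (fun _ => (1 : ℝ)) ξ := by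
    intro ξ
    rw [hgn]
    by_cases hξ : ξ ∈ A <;> simp [hξ]
  have hint : ∫ ξ, A.indicator (fun _ => (1 : ℝ)) ξ = a := by
    rw [integral_indicator hAm]; simp [ha, Measure.real]
  have hgL : MemLp g 2 := by
    refine MemLp.of_bound hgm.aestronglyMeasurable 1 (ae_of_all _ fun ξ => ?_)
    rw [hgn]
    by_cases hξ : ξ ∈ A <;> simp [hξ]
  have hgi : Integrable g := hgL.integrable one_le_two
  have hq0 : 0 < q := by linarith
  have hθ1 : 2 / q ≤ 1 := by rw [div_le_one hq0]; linarith
  have hV := sum_weight_mul_norm_fourierInt_sq_le hN hS hD hE hD0 (by positivity) hθ1 hK hgL ha0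
    (by simp_rw [hgn]; exact hint.le) (by simp_rw [hgsq]; exact hint.le)
  -- duality
  have hdual : lam * a ≤ ‖∑ n ∈ S, f n * (w n : ℂ) * fourierInt g n‖ := by
    have e : ∑ n ∈ S, f n * (w n : ℂ) * fourierInt g n = ∫ ξ, g ξ * F ξ := by
      simp_rw [hF, trigPoly, Finset.mul_sum]
      rw [integral_finsetSum]
      · refine Finset.sum_congr rfl fun n _ => ?_
        rw [fourierInt, ← integral_const_mul]
        refine integral_congr_ae (ae_of_all _ fun ξ => ?_)
        simp only
        ring
      · intro n _
        refine ((integrable_mul_fourier hgi n).const_mul (f n * (w n : ℂ))).congr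
          (ae_of_all _ fun ξ => ?_)
        simp only
        ring
    have e2 : ∀ ξ, g ξ * F ξ = ((A.indicator (fun ξ => ‖F ξ‖) ξ : ℝ) : ℂ) := by
      intro ξ
      by_cases hξ : ξ ∈ A
      · have : (‖F ξ‖ : ℂ) ≠ 0 := by
          have : 0 < ‖F ξ‖ := hlam.trans hξ
          exact_mod_cast this.ne'
        rw [hg, Set.indicator_of_mem hξ, Set.indicator_of_mem hξ, div_mul_eq_mul_div,
          Complex.conj_mul', pow_two, mul_div_assoc, div_self this, mul_one]
      · rw [hg, Set.indicator_of_notMem hξ, Set.indicator_of_notMem hξ]; simp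
    rw [e]
    simp_rw [e2]
    rw [integral_complex_ofReal, Complex.norm_real, Real.norm_eq_abs]
    refine le_trans ?_ (le_abs_self _)
    rw [← hint, ← integral_const_mul]
    refine integral_mono_of_nonneg (ae_of_all _ fun ξ => ?_) ?_ (ae_of_all _ fun ξ => ?_)
    · exact mul_nonneg hlam.le (Set.indicator_nonneg (fun _ _ => zero_le_one) _)
    · exact (continuous_trigPoly.norm.integrable_of_hasCompactSupport
        (HasCompactSupport.of_compactSpace _)).indicator hAm
    · by_cases hξ : ξ ∈ A
      · simp only [Set.indicator_of_mem hξ, mul_one]; exact (le_of_lt hξ)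
      · simp [hξ]
  have hmain : (lam * a) ^ 2 ≤ P * ((1 + K) * ((N : ℝ) ^ (-(2 / q)) * a ^ (2 - 2 / q))) := by
    refine (pow_le_pow_left₀ (by positivity) hdual 2).trans ?_
    refine (norm_sum_mul_weight_sq_le hw _).trans ?_
    gcongr
  set R := √((1 + K) * P) with hR
  have hRR : (1 + K) * P = R ^ 2 := (Real.sq_sqrt (by positivity)).symm
  have hR0 : 0 ≤ R := Real.sqrt_nonneg _
  -- solve for `a`
  have h2 : a ^ (2 / q) ≤ (R / lam) ^ 2 * (N : ℝ) ^ (-(2 / q)) := by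
    have e : a ^ (2 - 2 / q) * a ^ (2 / q) = a ^ 2 := by
      rw [← Real.rpow_add ha0, sub_add_cancel, Real.rpow_two]
    have h3 : a ^ (2 - 2 / q) * (lam ^ 2 * a ^ (2 / q))
        ≤ a ^ (2 - 2 / q) * (R ^ 2 * (N : ℝ) ^ (-(2 / q))) := by
      rw [← hRR]
      calc _ = lam ^ 2 * (a ^ (2 - 2 / q) * a ^ (2 / q)) := by ring
        _ = (lam * a) ^ 2 := by rw [e]; ring
        _ ≤ _ := hmain
        _ = _ := by ring
    have h4 := le_of_mul_le_mul_left h3 (by positivity)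
    rw [div_pow, div_mul_eq_mul_div, le_div_iff₀ (by positivity)]
    linarith
  have h5 := Real.rpow_le_rpow (by positivity) h2 (by positivity : 0 ≤ q / 2)
  rw [← Real.rpow_mul ha0.le, Real.mul_rpow (by positivity) (by positivity), ← Real.rpow_mul hN0.le,
    ← Real.rpow_natCast_mul (by positivity)] at h5
  have e1 : 2 / q * (q / 2) = 1 := by field_simp
  have e2 : -(2 / q) * (q / 2) = -1 := by field_simp
  have e3 : ((2 : ℕ) : ℝ) * (q / 2) = q := by push_cast; field_simp
  rw [e1, e2, e3, Real.rpow_one, Real.rpow_neg_one] at h5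
  exact h5

/-- Cauchy–Schwarz, with the total mass of `w` at most `1 + E` by the hypothesis at `ξ = 0`. -/
lemma norm_trigPoly_le {N : ℕ} {E : ℝ} (hN : 1 ≤ N) (hS : S.card = N) (hw : ∀ n ∈ S, 0 ≤ w n)
    (hE : ∀ ξ : UnitAddCircle, ‖∑ n ∈ S, ((w n - (N : ℝ)⁻¹ : ℝ) : ℂ) * fourier n ξ‖ ≤ E)
    (ξ : UnitAddCircle) :
    ‖trigPoly S w f ξ‖ ≤ √((1 + E) * ∑ n ∈ S, ‖f n‖ ^ 2 * w n) := by
  have hN0 : (N : ℝ) ≠ 0 := by exact_mod_cast (by omega : N ≠ 0)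
  refine Real.le_sqrt_of_sq_le ?_
  refine (norm_sum_mul_weight_sq_le hw _).trans ?_
  simp_rw [norm_fourier_apply, one_pow, mul_one]
  rw [mul_comm]
  have h0 := hE 0
  simp_rw [fourier_eval_zero, mul_one] at h0
  rw [← Complex.ofReal_sum, Complex.norm_real, Real.norm_eq_abs, Finset.sum_sub_distrib,
    Finset.sum_const, nsmul_eq_mul, hS, mul_inv_cancel₀ hN0] at h0
  have := (abs_le.1 h0).2
  exact mul_le_mul_of_nonneg_right (by linarith)
    (Finset.sum_nonneg fun n hn => mul_nonneg (sq_nonneg _) (hw n hn))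

end Restriction

/-- A bounded function satisfying a weak type estimate satisfies the strong type estimates with
larger exponents. -/
lemma lintegral_rpow_le_of_level {α : Type*} [MeasurableSpace α] {μ : Measure α} {F : α → ℝ}
    {p q R M : ℝ} (hF : Measurable F) (hF0 : ∀ x, 0 ≤ F x) (hq : 0 < q) (hqp : q < p)
    (hR : 0 ≤ R) (hM : 0 ≤ M) (hFR : ∀ x, F x ≤ R)
    (hweak : ∀ t : ℝ, 0 < t → μ {x | t < F x} ≤ ENNReal.ofReal ((R / t) ^ q * M)) :
    ∫⁻ x, ENNReal.ofReal (F x ^ p) ∂μ ≤ ENNReal.ofReal (p / (p - q) * M * R ^ p) := by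
  have hp : 0 < p := hq.trans hqp
  rw [lintegral_rpow_eq_lintegral_meas_lt_mul μ (ae_of_all _ hF0) hF.aemeasurable hp]
  -- In the layer cake formula the levels above `R` are empty; below `R` the weak bound leaves `t ^
  -- (p - q - 1)`, integrable at `0` because `q < p`.
  have h1 : ∫⁻ t in Set.Ioi (0 : ℝ), μ {x | t < F x} * ENNReal.ofReal (t ^ (p - 1))
      ≤ ∫⁻ t in Set.Ioc 0 R, ENNReal.ofReal (R ^ q * M * t ^ (p - q - 1)) := by
    rw [← lintegral_indicator measurableSet_Ioi, ← lintegral_indicator measurableSet_Ioc]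
    refine lintegral_mono fun t => ?_
    by_cases ht : 0 < t
    · rw [Set.indicator_of_mem (Set.mem_Ioi.2 ht)]
      rcases le_or_gt t R with htR | htR
      · rw [Set.indicator_of_mem (Set.mem_Ioc.2 ⟨ht, htR⟩)]
        refine (mul_le_mul_left (hweak t ht) _).trans (le_of_eq ?_)
        rw [← ENNReal.ofReal_mul (by positivity)]
        congr 1
        rw [Real.div_rpow hR ht.le, show p - 1 = q + (p - q - 1) by ring, Real.rpow_add ht]
        field_simp
      · have : {x | t < F x} = ∅ := by
          ext x; simp only [Set.mem_ofPred_eq, Set.mem_empty_iff_false, iff_false, not_lt]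
          exact (hFR x).trans htR.le
        rw [this]; simp
    · rw [Set.indicator_of_notMem (by simpa using ht)]; exact zero_le
  have hint : IntervalIntegrable (fun t : ℝ => R ^ q * M * t ^ (p - q - 1)) volume 0 R :=
    (intervalIntegral.intervalIntegrable_rpow' (by linarith)).const_mul _
  have h2 : ∫⁻ t in Set.Ioc 0 R, ENNReal.ofReal (R ^ q * M * t ^ (p - q - 1))
      = ENNReal.ofReal (R ^ q * M * (R ^ (p - q) / (p - q))) := by
    rw [← ofReal_integral_eq_lintegral_ofReal]
    · rw [← intervalIntegral.integral_of_le hR, intervalIntegral.integral_const_mul,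
        integral_rpow (Or.inl (by linarith)), sub_add_cancel, Real.zero_rpow (by linarith), sub_zero]
    · exact (intervalIntegrable_iff_integrableOn_Ioc_of_le hR).1 hint
    · refine (ae_restrict_iff' measurableSet_Ioc).2 (ae_of_all _ fun t ht => ?_)
      have := ht.1.le
      simp only [Pi.zero_apply]
      positivity
  refine (mul_le_mul_right (h1.trans h2.le) _).trans (le_of_eq ?_)
  rw [← ENNReal.ofReal_mul hp.le]
  congr 1
  rcases hR.eq_or_lt with rfl | hR'
  · rw [Real.zero_rpow hq.ne', Real.zero_rpow hp.ne']; ring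
  · have : p - q ≠ 0 := by linarith
    rw [show R ^ p = R ^ q * R ^ (p - q) by rw [← Real.rpow_add hR']; congr 1; ring]
    field_simp

/-- The restriction estimate for weights which are close to the uniform ones in the sense of
their Fourier transforms. -/
theorem eLpNorm_trigPoly_le {S : Finset ℤ} {w : ℤ → ℝ} {f : ℤ → ℂ} {N : ℕ} {D E K p q : ℝ}
    (hq : 2 < q) (hqp : q < p)
    (hN : 1 ≤ N) (hS : S.card = N) (hw : ∀ n ∈ S, 0 ≤ w n)
    (hD0 : 0 ≤ D) (hD : ∀ n ∈ S, |w n - (N : ℝ)⁻¹| ≤ D)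
    (hE : ∀ ξ : UnitAddCircle, ‖∑ n ∈ S, ((w n - (N : ℝ)⁻¹ : ℝ) : ℂ) * fourier n ξ‖ ≤ E)
    (hEK : E ≤ K) (hK : D ^ (2 / q) * E ^ (1 - 2 / q) ≤ K * (N : ℝ) ^ (-(2 / q))) :
    eLpNorm (trigPoly S w f) (ENNReal.ofReal p) volume
      ≤ ENNReal.ofReal ((p / (p - q)) ^ (1 / p) * √(1 + K) * (N : ℝ) ^ (-1 / p))
        * ENNReal.ofReal √(∑ n ∈ S, ‖f n‖ ^ 2 * w n) := by
  have hE0 : 0 ≤ E := (norm_nonneg _).trans (hE 0)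
  have hK0 : 0 ≤ K := hE0.trans hEK
  have hp : 0 < p := by linarith
  have hpq : 0 < p - q := by linarith
  have hN0 : (0 : ℝ) < N := by exact_mod_cast hN
  set P := ∑ n ∈ S, ‖f n‖ ^ 2 * w n with hP
  have hP0 : 0 ≤ P := Finset.sum_nonneg fun n hn => mul_nonneg (sq_nonneg _) (hw n hn)
  rw [eLpNorm_eq_lintegral_rpow_enorm_toReal (by simpa using hp) ENNReal.ofReal_ne_top,
    ENNReal.toReal_ofReal hp.le]
  -- Since `E ≤ K`, the same `R` serves in the sup bound and in the weak type bound.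
  have h := lintegral_rpow_le_of_level (μ := (volume : Measure UnitAddCircle))
    (F := fun ξ => ‖trigPoly S w f ξ‖) (p := p) (q := q) (R := √((1 + K) * P)) (M := (N : ℝ)⁻¹)
    continuous_trigPoly.norm.measurable (fun _ => norm_nonneg _) (by linarith) hqp
    (Real.sqrt_nonneg _) (by positivity)
    (fun ξ => (norm_trigPoly_le hN hS hw hE ξ).trans (Real.sqrt_le_sqrt (by gcongr)))
    (fun t ht => by
      rw [← ofReal_measureReal]
      exact ENNReal.ofReal_le_ofReal (volume_level_le hq ht hN hS hw hD0 hD hE hK0 hK))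
  have e : ∀ ξ, ‖trigPoly S w f ξ‖ₑ ^ p = ENNReal.ofReal (‖trigPoly S w f ξ‖ ^ p) := by
    intro ξ
    rw [← ofReal_norm, ENNReal.ofReal_rpow_of_nonneg (norm_nonneg _) hp.le]
  simp_rw [e]
  refine (ENNReal.rpow_le_rpow h (by positivity)).trans (le_of_eq ?_)
  rw [ENNReal.ofReal_rpow_of_nonneg (by positivity) (by positivity),
    ← ENNReal.ofReal_mul (by positivity)]
  congr 1
  rw [Real.mul_rpow (by positivity) (by positivity), Real.mul_rpow (by positivity) (by positivity),
    ← Real.rpow_mul (Real.sqrt_nonneg _), mul_one_div_cancel hp.ne', Real.rpow_one,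
    Real.sqrt_mul (by positivity), Real.inv_rpow hN0.le, ← Real.rpow_neg hN0.le,
    show -(1 / p) = -1 / p by ring]
  ring

/-! ### Regular variation: sizes of the inverse functions and their derivatives. -/

section RegularVariation

lemma eventually_const_le_rpow (K : ℝ) {ε : ℝ} (hε : 0 < ε) : ∀ᶠ x : ℝ in atTop, K ≤ x ^ ε :=
  (tendsto_rpow_atTop hε).eventually_ge_atTop K

lemma eventually_mul_rpow_le {e₁ e₂ : ℝ} (K : ℝ) (h : e₁ < e₂) :
    ∀ᶠ x : ℝ in atTop, K * x ^ e₁ ≤ x ^ e₂ := by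
  filter_upwards [eventually_const_le_rpow K (sub_pos.2 h), eventually_gt_atTop 0] with x hx hx0
  calc K * x ^ e₁ ≤ x ^ (e₂ - e₁) * x ^ e₁ := by gcongr
    _ = x ^ e₂ := by rw [← Real.rpow_add hx0, sub_add_cancel]

lemma eventually_atTop_eventually_nhds {P : ℝ → Prop} (h : ∀ᶠ x in atTop, P x) :
    ∀ᶠ x in atTop, ∀ᶠ y in 𝓝 x, P y := by
  obtain ⟨a, ha⟩ := eventually_atTop.1 h
  filter_upwards [eventually_gt_atTop a] with x hx
  filter_upwards [Ioi_mem_nhds hx] with y hy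
  exact ha y (le_of_lt hy)

/-- The numerator `(c + ϑ)(c + ϑ - 1) + xϑ'` of `x²h''/h`. -/
noncomputable def convexityIndex (c : ℝ) (ϑ : ℝ → ℝ) (x : ℝ) : ℝ :=
  (c + ϑ x) * (c + ϑ x - 1) + x * deriv ϑ x

/-- `h` is `x ^ c * exp (∫ ϑ(t)/t dt)`, where `ϑ` tends to `0`, and `x²h''/h` decays and grows
slower than any power. -/
structure IsPowerLike (c x₀ : ℝ) (h ϑ : ℝ → ℝ) : Prop where
  one_le : 1 ≤ c
  pos : 0 < x₀
  strictMono : StrictMonoOn h (Set.Ici x₀)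
  contDiffOn : ContDiffOn ℝ 2 ϑ (Set.Ici x₀)
  eq : ∀ x, x₀ ≤ x → h x = x ^ c * Real.exp (∫ t in x₀..x, ϑ t / t)
  lim : Tendsto ϑ atTop (𝓝 0)
  lower : ∀ ε : ℝ, 0 < ε → ∀ᶠ x in atTop, x ^ (-ε) ≤ convexityIndex c ϑ x
  upper : ∀ ε : ℝ, 0 < ε → ∀ᶠ x in atTop, convexityIndex c ϑ x ≤ x ^ ε

/-- For `c > 1` the convexity index tends to `c (c - 1) > 0`. For `c = 1` it is asymptotic to `ϑ`,
which tends to `0` but more slowly than any power. Bounds up to `x ^ ε` cover both cases at once. -/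
lemma ClassR.exists_isPowerLike {c x₀ : ℝ} {h : ℝ → ℝ} (hh : ClassR c x₀ h) (hc : 1 ≤ c) :
    ∃ ϑ, IsPowerLike c x₀ h ϑ := by
  obtain ⟨-, -, hmono, -, L, hL, hL0, hhL⟩ := hh
  rcases eq_or_ne c 1 with rfl | hc1
  · obtain ⟨hx0, -, ⟨ϑ, hsm, hint, hpos, -, hlim, hlim1, -, hslow⟩, -⟩ := hL0 rfl
    have hfac : Tendsto (fun x => 1 + ϑ x + x * deriv ϑ x / ϑ x) atTop (𝓝 1) := by
      simpa using (tendsto_const_nhds.add hlim).add hlim1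
    have hidx : ∀ x, x₀ ≤ x →
        convexityIndex 1 ϑ x = ϑ x * (1 + ϑ x + x * deriv ϑ x / ϑ x) := by
      intro x hx
      have := (hpos x hx).ne'
      rw [convexityIndex]; field_simp; ring
    refine ⟨ϑ, le_rfl, hx0, hmono, hsm, fun x hx => by rw [hhL x hx, hint x hx], hlim, ?_, ?_⟩
    · intro ε hε
      obtain ⟨C, hC, hCx⟩ := hslow (ε / 2) (by positivity)
      filter_upwards [hfac.eventually_const_le (show (1 / 2 : ℝ) < 1 by norm_num),
        eventually_ge_atTop x₀, eventually_mul_rpow_le (2 * C) (show -ε < -(ε / 2) by linarith),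
        eventually_gt_atTop 0] with x h1 h2 h3 h4
      rw [hidx x h2]
      have h5 := hCx x h2
      have h6 : x ^ (-(ε / 2)) ≤ C * ϑ x := by
        rw [Real.rpow_neg h4.le, inv_eq_one_div, div_le_iff₀ (by positivity)]
        exact h5
      have h7 := hpos x h2
      have h8 : x ^ (-ε) ≤ ϑ x * (1 / 2) := by
        have : 2 * C * x ^ (-ε) ≤ 2 * C * (ϑ x * (1 / 2)) := by linarith
        exact le_of_mul_le_mul_left this (by positivity)
      exact h8.trans (by gcongr)
    · intro ε hε
      have : Tendsto (fun x => ϑ x * (1 + ϑ x + x * deriv ϑ x / ϑ x)) atTop (𝓝 0) := by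
        simpa using hlim.mul hfac
      filter_upwards [this.eventually_le_const zero_lt_one, eventually_ge_atTop x₀,
        eventually_const_le_rpow 1 hε] with x h1 h2 h3
      rw [hidx x h2]
      exact h1.trans h3
  · obtain ⟨hx0, -, ϑ, hsm, hint, hlim, hlim1, -⟩ := hL hc1
    have hfac : Tendsto (convexityIndex c ϑ) atTop (𝓝 (c * (c - 1))) := by
      have h1 : Tendsto (fun x => c + ϑ x) atTop (𝓝 c) := by
        simpa using tendsto_const_nhds.add hlim
      exact (by simpa using (h1.mul (h1.sub_const 1)).add hlim1 :
      Tendsto (fun x => (c + ϑ x) * (c + ϑ x - 1) + x * deriv ϑ x) atTop (𝓝 (c * (c - 1))))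
    have hpos : 0 < c * (c - 1) := by
      have : 1 < c := lt_of_le_of_ne hc (Ne.symm hc1)
      nlinarith
    refine ⟨ϑ, hc, hx0, hmono, hsm, fun x hx => by rw [hhL x hx, hint x hx], hlim, ?_, ?_⟩
    · intro ε hε
      filter_upwards [hfac.eventually_const_le (half_lt_self hpos),
        (tendsto_rpow_neg_atTop hε).eventually_le_const (half_pos hpos)] with x h1 h2
      exact h2.trans h1
    · intro ε hε
      filter_upwards [hfac.eventually_le_const (lt_add_one _),
        eventually_const_le_rpow (c * (c - 1) + 1) hε] with x h1 h2
      exact h1.trans h2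

namespace IsPowerLike

variable {c x₀ : ℝ} {h ϑ : ℝ → ℝ}

lemma hasDerivAt_index (H : IsPowerLike c x₀ h ϑ) {x : ℝ} (hx : x₀ < x) :
    HasDerivAt ϑ (deriv ϑ x) x :=
  ((H.contDiffOn.contDiffAt (Ici_mem_nhds hx)).differentiableAt (by norm_num)).hasDerivAt

lemma pos_of_ge (H : IsPowerLike c x₀ h ϑ) {x : ℝ} (hx : x₀ ≤ x) : 0 < h x := by
  have := H.pos.trans_le hx
  rw [H.eq x hx]; positivity

lemma hasDerivAt (H : IsPowerLike c x₀ h ϑ) {x : ℝ} (hx : x₀ < x) :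
    HasDerivAt h (h x * (c + ϑ x) / x) x := by
  have hx0 : 0 < x := H.pos.trans hx
  have hcont : ContinuousOn (fun t => ϑ t / t) (Set.Ici x₀) :=
    H.contDiffOn.continuousOn.div continuousOn_id fun t ht => (H.pos.trans_le ht).ne'
  have h1 : HasDerivAt (fun u => ∫ t in x₀..u, ϑ t / t) (ϑ x / x) x := by
    refine intervalIntegral.integral_hasDerivAt_right ?_ ?_ ?_
    · refine (hcont.mono ?_).intervalIntegrable
      rw [Set.uIcc_of_le hx.le]
      exact Set.Icc_subset_Ici_self
    · exact (hcont.mono Set.Ioi_subset_Ici_self).stronglyMeasurableAtFilter isOpen_Ioi x hx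
    · exact hcont.continuousAt (Ici_mem_nhds hx)
  have h2 := (Real.hasDerivAt_rpow_const (p := c) (Or.inl hx0.ne')).mul h1.exp
  have h3 : HasDerivAt h _ x := h2.congr_of_eventuallyEq (by
    filter_upwards [Ici_mem_nhds hx] with y hy
    exact H.eq y hy)
  convert h3 using 1
  rw [H.eq x hx.le, Real.rpow_sub_one hx0.ne']
  ring

lemma tendsto_add (H : IsPowerLike c x₀ h ϑ) : Tendsto (fun x => c + ϑ x) atTop (𝓝 c) := by
  simpa using tendsto_const_nhds.add H.lim

lemma hasDerivAt_log_sub (H : IsPowerLike c x₀ h ϑ) (e : ℝ) {x : ℝ} (hx : x₀ < x) :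
    HasDerivAt (fun x => Real.log (h x) - e * Real.log x) ((c + ϑ x - e) / x) x := by
  have hx0 : 0 < x := H.pos.trans hx
  have hh := H.pos_of_ge hx.le
  refine (((H.hasDerivAt hx).log hh.ne').sub
    ((Real.hasDerivAt_log hx0.ne').const_mul e)).congr_deriv ?_
  field_simp

/-- As `x h' / h = c + ϑ`, the function `h x / x ^ (c + ε/2)` eventually decreases; the other half
of `ε` absorbs the constant. The lower bound is symmetric. -/
lemma eventually_le_rpow (H : IsPowerLike c x₀ h ϑ) {ε : ℝ} (hε : 0 < ε) :
    ∀ᶠ x in atTop, h x ≤ x ^ (c + ε) := by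
  obtain ⟨X, hX⟩ := eventually_atTop.1 ((H.tendsto_add.eventually_le_const
    (show c < c + ε / 2 by linarith)).and (eventually_gt_atTop x₀))
  have hanti : AntitoneOn (fun x => Real.log (h x) - (c + ε / 2) * Real.log x) (Set.Ici X) := by
    refine antitoneOn_of_deriv_nonpos (convex_Ici X)
      (fun x hx => (H.hasDerivAt_log_sub _ (hX x hx).2).continuousAt.continuousWithinAt)
      (fun x hx => (H.hasDerivAt_log_sub _
        (hX x (interior_subset hx)).2).differentiableAt.differentiableWithinAt) fun x hx => ?_
    have := hX x (interior_subset hx)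
    rw [(H.hasDerivAt_log_sub _ this.2).deriv]
    exact div_nonpos_of_nonpos_of_nonneg (by linarith [this.1]) (H.pos.trans this.2).le
  filter_upwards [eventually_ge_atTop X, Real.tendsto_log_atTop.eventually_ge_atTop
    ((Real.log (h X) - (c + ε / 2) * Real.log X) / (ε / 2))] with x hx hl
  have h1 := hanti (Set.mem_Ici.2 le_rfl) hx hx
  simp only at h1
  rw [div_le_iff₀ (by positivity)] at hl
  have hx0 := H.pos.trans (hX x hx).2
  rw [← Real.log_le_log_iff (H.pos_of_ge (hX x hx).2.le) (by positivity), Real.log_rpow hx0]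
  linarith

lemma eventually_rpow_le (H : IsPowerLike c x₀ h ϑ) {ε : ℝ} (hε : 0 < ε) :
    ∀ᶠ x in atTop, x ^ (c - ε) ≤ h x := by
  obtain ⟨X, hX⟩ := eventually_atTop.1 ((H.tendsto_add.eventually_const_le
    (show c - ε / 2 < c by linarith)).and (eventually_gt_atTop x₀))
  have hmono : MonotoneOn (fun x => Real.log (h x) - (c - ε / 2) * Real.log x) (Set.Ici X) := by
    refine monotoneOn_of_deriv_nonneg (convex_Ici X)
      (fun x hx => (H.hasDerivAt_log_sub _ (hX x hx).2).continuousAt.continuousWithinAt)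
      (fun x hx => (H.hasDerivAt_log_sub _
        (hX x (interior_subset hx)).2).differentiableAt.differentiableWithinAt) fun x hx => ?_
    have := hX x (interior_subset hx)
    rw [(H.hasDerivAt_log_sub _ this.2).deriv]
    exact div_nonneg (by linarith [this.1]) (H.pos.trans this.2).le
  filter_upwards [eventually_ge_atTop X, Real.tendsto_log_atTop.eventually_ge_atTop
    (-(Real.log (h X) - (c - ε / 2) * Real.log X) / (ε / 2))] with x hx hl
  have h1 := hmono (Set.mem_Ici.2 le_rfl) hx hx
  simp only at h1
  rw [div_le_iff₀ (by positivity)] at hl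
  have hx0 := H.pos.trans (hX x hx).2
  rw [← Real.log_le_log_iff (by positivity) (H.pos_of_ge (hX x hx).2.le), Real.log_rpow hx0]
  linarith

lemma tendsto_atTop (H : IsPowerLike c x₀ h ϑ) : Tendsto h atTop atTop := by
  have hc := H.one_le
  refine tendsto_atTop_mono' _ (H.eventually_rpow_le (ε := 1 / 2) (by norm_num)) ?_
  exact tendsto_rpow_atTop (by linarith)

lemma continuousOn (H : IsPowerLike c x₀ h ϑ) : ContinuousOn h (Set.Ici (x₀ + 1)) :=
  fun _ hx => (H.hasDerivAt (lt_of_lt_of_le (lt_add_one _) hx)).continuousAt.continuousWithinAt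

/-- `Function.invFunOn` is meaningful only at attained values; the intermediate value theorem
supplies these. Starting at `x₀ + 1` avoids the end point, where differentiability of `h` is not
available. -/
lemma inverse_spec (H : IsPowerLike c x₀ h ϑ) {X y : ℝ} (hX : x₀ + 1 ≤ X) (hy : h X ≤ y) :
    X ≤ inverse x₀ h y ∧ h (inverse x₀ h y) = y := by
  obtain ⟨Z, hZX, hZ⟩ := ((eventually_ge_atTop X).and (H.tendsto_atTop.eventually_ge_atTop y)).exists
  obtain ⟨x, hx, hxy⟩ := intermediate_value_Icc hZX
    (H.continuousOn.mono (fun t ht => hX.trans ht.1)) ⟨hy, hZ⟩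
  have hex : ∃ x ∈ Set.Ici x₀, h x = y := ⟨x, by rw [Set.mem_Ici]; linarith [hx.1], hxy⟩
  have h1 : inverse x₀ h y ∈ Set.Ici x₀ := Function.invFunOn_mem hex
  have h2 : h (inverse x₀ h y) = y := Function.invFunOn_eq hex
  refine ⟨?_, h2⟩
  by_contra! hlt
  have := H.strictMono h1 (by rw [Set.mem_Ici]; linarith) hlt
  linarith

lemma inverse_apply (H : IsPowerLike c x₀ h ϑ) {x : ℝ} (hx : x₀ + 1 ≤ x) :
    inverse x₀ h (h x) = x := by
  have := H.inverse_spec hx le_rfl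
  exact H.strictMono.injOn (by rw [Set.mem_Ici]; linarith) (by rw [Set.mem_Ici]; linarith) this.2

lemma tendsto_inverse (H : IsPowerLike c x₀ h ϑ) : Tendsto (inverse x₀ h) atTop atTop := by
  refine Filter.tendsto_atTop.2 fun M => ?_
  filter_upwards [eventually_ge_atTop (h (max M (x₀ + 1)))] with y hy
  exact (le_max_left _ _).trans (H.inverse_spec (le_max_right _ _) hy).1

lemma continuousAt_inverse (H : IsPowerLike c x₀ h ϑ) {y : ℝ} (hy : h (x₀ + 1) < y) :
    ContinuousAt (inverse x₀ h) y := by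
  have hmono : StrictMonoOn (inverse x₀ h) (Set.Ici (h (x₀ + 1))) := by
    intro a ha b hb hab
    by_contra! hle
    obtain ⟨ha1, ha2⟩ := H.inverse_spec le_rfl ha
    obtain ⟨hb1, hb2⟩ := H.inverse_spec le_rfl hb
    have := H.strictMono.monotoneOn (by rw [Set.mem_Ici]; linarith)
      (by rw [Set.mem_Ici]; linarith) hle
    linarith
  refine hmono.continuousAt_of_image_mem_nhds (Ici_mem_nhds hy) ?_
  obtain ⟨h1, h2⟩ := H.inverse_spec le_rfl hy.le
  have h3 : x₀ + 1 < inverse x₀ h y := by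
    refine lt_of_le_of_ne h1 fun he => ?_
    rw [← he] at h2
    linarith
  refine mem_of_superset (Ici_mem_nhds h3) fun x hx => ⟨h x, ?_, H.inverse_apply hx⟩
  have hx' : x₀ + 1 ≤ x := hx
  exact H.strictMono.monotoneOn (by rw [Set.mem_Ici]; linarith) (by rw [Set.mem_Ici]; linarith) hx

lemma eventually_add_mem (H : IsPowerLike c x₀ h ϑ) :
    ∀ᶠ y in atTop, 1 / 2 ≤ c + ϑ (inverse x₀ h y) ∧ c + ϑ (inverse x₀ h y) ≤ c + 1 := by
  have h1 := H.tendsto_add.comp H.tendsto_inverse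
  have hc := H.one_le
  exact (h1.eventually_const_le (by linarith)).and (h1.eventually_le_const (by linarith))

lemma eventually_inverse_spec (H : IsPowerLike c x₀ h ϑ) :
    ∀ᶠ y in atTop, x₀ < inverse x₀ h y ∧ h (inverse x₀ h y) = y := by
  filter_upwards [eventually_ge_atTop (h (x₀ + 1))] with y hy
  obtain ⟨h1, h2⟩ := H.inverse_spec le_rfl hy
  exact ⟨by linarith, h2⟩

lemma eventually_hasDerivAt_inverse (H : IsPowerLike c x₀ h ϑ) :
    ∀ᶠ y in atTop, HasDerivAt (inverse x₀ h)
      (inverse x₀ h y / (y * (c + ϑ (inverse x₀ h y)))) y := by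
  filter_upwards [eventually_gt_atTop (h (x₀ + 1)), H.eventually_add_mem,
    H.eventually_inverse_spec, eventually_atTop_eventually_nhds H.eventually_inverse_spec,
    eventually_gt_atTop 0] with y hy hadd hsp hspn hy0
  have hx0 := H.pos.trans hsp.1
  have h1 := H.hasDerivAt hsp.1
  rw [hsp.2] at h1
  have h2 : y * (c + ϑ (inverse x₀ h y)) / inverse x₀ h y ≠ 0 := by
    have : 0 < c + ϑ (inverse x₀ h y) := by linarith [hadd.1]
    positivity
  have h3 := HasDerivAt.of_local_left_inverse (H.continuousAt_inverse hy) h1 h2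
    (hspn.mono fun z hz => hz.2)
  rwa [inv_div] at h3

lemma eventually_deriv_inverse (H : IsPowerLike c x₀ h ϑ) :
    ∀ᶠ y in atTop, deriv (inverse x₀ h) y
      = inverse x₀ h y / (y * (c + ϑ (inverse x₀ h y))) :=
  H.eventually_hasDerivAt_inverse.mono fun _ hy => hy.deriv

/-- Obtained by differentiating `φ / (y (c + ϑ(φ)))`; the result is `-h'' / h'³` at `φ(y)`, with
`h''` expressed through the convexity index. -/
lemma eventually_hasDerivAt_deriv_inverse (H : IsPowerLike c x₀ h ϑ) :
    ∀ᶠ y in atTop, HasDerivAt (deriv (inverse x₀ h))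
      (-(convexityIndex c ϑ (inverse x₀ h y) * inverse x₀ h y
        / (y ^ 2 * (c + ϑ (inverse x₀ h y)) ^ 3))) y := by
  filter_upwards [H.eventually_hasDerivAt_inverse, H.eventually_add_mem, H.eventually_inverse_spec,
    eventually_atTop_eventually_nhds H.eventually_deriv_inverse, eventually_gt_atTop 0]
    with y hd hadd hsp hdn hy0
  have hs : 0 < c + ϑ (inverse x₀ h y) := by linarith [hadd.1]
  have h1 := ((H.hasDerivAt_index hsp.1).comp y hd).const_add c
  have h2 := hd.div ((hasDerivAt_id y).mul h1) (by
    simp only [Pi.mul_apply, id_eq, Function.comp_apply]; positivity)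
  have h3 := h2.congr_of_eventuallyEq (f₁ := deriv (inverse x₀ h)) (by
    filter_upwards [hdn] with z hz
    simpa using hz)
  refine h3.congr_deriv ?_
  simp only [Pi.mul_apply, id_eq, Function.comp_apply, convexityIndex]
  generalize inverse x₀ h y = x at *
  generalize deriv ϑ x = ϑ' at *
  obtain ⟨s, hs'⟩ : ∃ s, s = c + ϑ x := ⟨_, rfl⟩
  rw [← hs'] at hs ⊢
  field_simp
  ring

lemma eventually_inverse_bounds (H : IsPowerLike c x₀ h ϑ) {ε : ℝ} (hε : 0 < ε) :
    ∀ᶠ y in atTop, y ^ (1 / c - ε) ≤ inverse x₀ h y ∧ inverse x₀ h y ≤ y ^ (1 / c + ε) := by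
  have hc := H.one_le
  -- As `c ≥ 1` and `η ≤ 1/2`, both `1 / (c - η)` and `1 / (c + η)` differ from `1 / c` by at most
  -- `2 * η ≤ ε`.
  set η := min (1 / 2) (ε / 2) with hη
  have hη0 : 0 < η := by positivity
  have hη1 : η ≤ 1 / 2 := min_le_left _ _
  have hη2 : η ≤ ε / 2 := min_le_right _ _
  have e1 : 1 / (c - η) ≤ 1 / c + ε := by
    have : 1 / (c - η) - 1 / c = η / (c * (c - η)) := by
      have : c - η ≠ 0 := by linarith
      field_simp; ring
    have h2 : η / (c * (c - η)) ≤ η / (1 * (1 / 2)) := by gcongr; linarith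
    have h3 : η / (1 * (1 / 2)) = 2 * η := by ring
    linarith
  have e2 : 1 / c - ε ≤ 1 / (c + η) := by
    have : 1 / c - 1 / (c + η) = η / (c * (c + η)) := by field_simp; ring
    have h2 : η / (c * (c + η)) ≤ η / (1 * 1) := by gcongr; linarith
    rw [mul_one, div_one] at h2
    linarith
  filter_upwards [H.tendsto_inverse.eventually (H.eventually_le_rpow hη0),
    H.tendsto_inverse.eventually (H.eventually_rpow_le hη0), H.eventually_inverse_spec,
    eventually_ge_atTop 1] with y h1 h2 h3 hy
  rw [h3.2] at h1 h2
  have hx0 := H.pos.trans h3.1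
  have hcη : 0 < c - η := by linarith
  have hy0 : 0 < y := by linarith
  constructor
  · have := Real.rpow_le_rpow hy0.le h1 (by positivity : 0 ≤ 1 / (c + η))
    rw [← Real.rpow_mul hx0.le, mul_one_div_cancel (by positivity), Real.rpow_one] at this
    exact (Real.rpow_le_rpow_of_exponent_le hy e2).trans this
  · have := Real.rpow_le_rpow (by positivity) h2 (by positivity : 0 ≤ 1 / (c - η))
    rw [← Real.rpow_mul hx0.le, mul_one_div_cancel (by positivity), Real.rpow_one] at this
    exact this.trans (Real.rpow_le_rpow_of_exponent_le hy e1)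

lemma eventually_deriv_bounds (H : IsPowerLike c x₀ h ϑ) {ε : ℝ} (hε : 0 < ε) :
    ∀ᶠ y in atTop, y ^ (1 / c - 1 - ε) ≤ deriv (inverse x₀ h) y ∧
      deriv (inverse x₀ h) y ≤ y ^ (1 / c - 1 + ε) := by
  have hc := H.one_le
  filter_upwards [H.eventually_deriv_inverse, H.eventually_inverse_bounds (half_pos hε),
    H.eventually_add_mem, eventually_gt_atTop 0,
    eventually_mul_rpow_le (c + 1) (show 1 / c - 1 - ε < 1 / c - 1 - ε / 2 by linarith),
    eventually_mul_rpow_le 2 (show 1 / c - 1 + ε / 2 < 1 / c - 1 + ε by linarith)]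
    with y hd hb hadd hy h1 h2
  have hs : 0 < c + ϑ (inverse x₀ h y) := by linarith [hadd.1]
  have e1 : y ^ (1 / c - ε / 2) = y ^ (1 / c - 1 - ε / 2) * y := by
    rw [← Real.rpow_add_one hy.ne']; congr 1; ring
  have e2 : y ^ (1 / c + ε / 2) = y ^ (1 / c - 1 + ε / 2) * y := by
    rw [← Real.rpow_add_one hy.ne']; congr 1; ring
  rw [e1, e2] at hb
  rw [hd]
  constructor
  · rw [le_div_iff₀ (by positivity)]
    calc y ^ (1 / c - 1 - ε) * (y * (c + ϑ (inverse x₀ h y)))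
        ≤ y ^ (1 / c - 1 - ε) * (y * (c + 1)) := by gcongr; linarith [hadd.2]
      _ = (c + 1) * y ^ (1 / c - 1 - ε) * y := by ring
      _ ≤ y ^ (1 / c - 1 - ε / 2) * y := by gcongr
      _ ≤ _ := hb.1
  · rw [div_le_iff₀ (by positivity)]
    calc inverse x₀ h y ≤ y ^ (1 / c - 1 + ε / 2) * y := hb.2
      _ = 2 * y ^ (1 / c - 1 + ε / 2) * (y * (1 / 2)) := by ring
      _ ≤ y ^ (1 / c - 1 + ε) * (y * (c + ϑ (inverse x₀ h y))) := by gcongr; exact hadd.1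

lemma eventually_deriv_deriv_bounds (H : IsPowerLike c x₀ h ϑ) {ε : ℝ} (hε : 0 < ε) :
    ∀ᶠ y in atTop, y ^ (1 / c - 2 - ε) ≤ -deriv (deriv (inverse x₀ h)) y ∧
      -deriv (deriv (inverse x₀ h)) y ≤ y ^ (1 / c - 2 + ε) := by
  have hc := H.one_le
  set η := ε / 4 with hη
  have hη0 : 0 < η := by positivity
  have hc1 : 1 / c ≤ 1 := by rw [div_le_one (by linarith)]; exact hc
  filter_upwards [H.eventually_hasDerivAt_deriv_inverse, H.eventually_inverse_bounds hη0,
    H.eventually_inverse_bounds zero_lt_one, H.eventually_inverse_spec,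
    H.tendsto_inverse.eventually (H.lower η hη0), H.tendsto_inverse.eventually (H.upper η hη0),
    H.eventually_add_mem, eventually_ge_atTop 1,
    eventually_mul_rpow_le ((c + 1) ^ 3) (show 1 / c - 2 - 4 * η < 1 / c - 2 - 3 * η by linarith),
    eventually_mul_rpow_le 8 (show 1 / c - 2 + 3 * η < 1 / c - 2 + 4 * η by linarith)]
    with y hd hb hb1 hsp hlo hup hadd hy1 h1 h2
  have hy : 0 < y := by linarith
  rw [hd.deriv, neg_neg, show ε = 4 * η by rw [hη]; ring]
  have hx0 : 0 < inverse x₀ h y := H.pos.trans hsp.1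
  have hs : 0 < c + ϑ (inverse x₀ h y) := by linarith [hadd.1]
  set x := inverse x₀ h y with hx
  -- A crude bound, used only to pass from `x ^ (±η)` to `y ^ (±2η)`; with the `η` lost on `φ` this
  -- makes `3η`, and the fourth `η` absorbs constants.
  have hx2 : x ≤ y ^ (2 : ℝ) :=
    hb1.2.trans (Real.rpow_le_rpow_of_exponent_le hy1 (by linarith))
  have hup' : convexityIndex c ϑ x ≤ y ^ (2 * η) := by
    refine hup.trans ?_
    rw [Real.rpow_mul hy.le]
    gcongr
  have hlo' : y ^ (-(2 * η)) ≤ convexityIndex c ϑ x := by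
    refine le_trans ?_ hlo
    rw [← mul_neg, Real.rpow_mul hy.le]
    exact Real.rpow_le_rpow_of_nonpos hx0 hx2 (by linarith)
  have hb0 : 0 ≤ convexityIndex c ϑ x := le_trans (by positivity) hlo'
  have e1 : y ^ (-(2 * η)) * y ^ (1 / c - η) = y ^ (1 / c - 2 - 3 * η) * y ^ 2 := by
    rw [← Real.rpow_natCast, ← Real.rpow_add hy, ← Real.rpow_add hy]
    congr 1; push_cast; ring
  have e2 : y ^ (2 * η) * y ^ (1 / c + η) = y ^ (1 / c - 2 + 3 * η) * y ^ 2 := by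
    rw [← Real.rpow_natCast, ← Real.rpow_add hy, ← Real.rpow_add hy]
    congr 1; push_cast; ring
  constructor
  · rw [le_div_iff₀ (by positivity)]
    calc y ^ (1 / c - 2 - 4 * η) * (y ^ 2 * (c + ϑ x) ^ 3)
        ≤ y ^ (1 / c - 2 - 4 * η) * (y ^ 2 * (c + 1) ^ 3) := by gcongr; linarith [hadd.2]
      _ = (c + 1) ^ 3 * y ^ (1 / c - 2 - 4 * η) * y ^ 2 := by ring
      _ ≤ y ^ (1 / c - 2 - 3 * η) * y ^ 2 := by gcongr
      _ = y ^ (-(2 * η)) * y ^ (1 / c - η) := e1.symm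
      _ ≤ convexityIndex c ϑ x * x := by gcongr; exact hb.1
  · rw [div_le_iff₀ (by positivity)]
    calc convexityIndex c ϑ x * x ≤ y ^ (2 * η) * y ^ (1 / c + η) := by gcongr; exact hb.2
      _ = y ^ (1 / c - 2 + 3 * η) * y ^ 2 := e2
      _ = 8 * y ^ (1 / c - 2 + 3 * η) * (y ^ 2 * (1 / 2) ^ 3) := by ring
      _ ≤ y ^ (1 / c - 2 + 4 * η) * (y ^ 2 * (c + ϑ x) ^ 3) := by gcongr; exact hadd.1

/-- The second differences of the inverse function along the integers. -/
lemma eventually_second_difference_bounds (H : IsPowerLike c x₀ h ϑ) {ε : ℝ} (hε : 0 < ε)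
    (hε1 : ε ≤ 1) :
    ∀ᶠ y in atTop, y ^ (1 / c - 2 - ε) ≤ -((inverse x₀ h (y + 2) - inverse x₀ h (y + 1))
        - (inverse x₀ h (y + 1) - inverse x₀ h y)) ∧
      -((inverse x₀ h (y + 2) - inverse x₀ h (y + 1))
        - (inverse x₀ h (y + 1) - inverse x₀ h y)) ≤ y ^ (1 / c - 2 + ε) := by
  have hc := H.one_le
  have hc1 : 1 / c ≤ 1 := by rw [div_le_one (by linarith)]; exact hc
  have hc0 : 0 < 1 / c := by positivity
  -- `η ≤ 1 / c` keeps the exponent `1 / c - 2 - η` above `-2`, as the comparison of powers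
  -- requires.
  set η := min (1 / c) (ε / 2) with hη
  have hη0 : 0 < η := by positivity
  have hη1 : η ≤ 1 / c := min_le_left _ _
  have hη2 : η ≤ ε / 2 := min_le_right _ _
  obtain ⟨Y, hY⟩ := eventually_atTop.1 ((H.eventually_hasDerivAt_inverse.and
    H.eventually_hasDerivAt_deriv_inverse).and (H.eventually_deriv_deriv_bounds hη0))
  filter_upwards [eventually_ge_atTop Y, eventually_ge_atTop 2,
    eventually_mul_rpow_le 4 (show 1 / c - 2 - ε < 1 / c - 2 - η by linarith),
    eventually_mul_rpow_le 4 (show 1 / c - 2 + η < 1 / c - 2 + ε by linarith)] with y hyY hy2 h1 h2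
  set φ := inverse x₀ h with hφ
  have hd : ∀ z, Y ≤ z → HasDerivAt φ (deriv φ z) z := fun z hz =>
    (hY z hz).1.1.differentiableAt.hasDerivAt
  have hdd : ∀ z, Y ≤ z → HasDerivAt (deriv φ) (deriv (deriv φ) z) z := fun z hz =>
    (hY z hz).1.2.differentiableAt.hasDerivAt
  have hG : ∀ z, Y ≤ z → HasDerivAt (fun z => φ (z + 1) - φ z) (deriv φ (z + 1) - deriv φ z) z :=
    fun z hz => ((hd (z + 1) (by linarith)).comp_add_const z 1).sub (hd z hz)
  -- Two applications of the mean value theorem, to `φ (z + 1) - φ z` and then to `φ'`, show that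
  -- the second difference is `φ''` at some point of `(y, y + 2)`.
  obtain ⟨ξ, hξ, hξe⟩ := exists_hasDerivAt_eq_slope (fun z => φ (z + 1) - φ z)
    (fun z => deriv φ (z + 1) - deriv φ z) (show y < y + 1 by linarith)
    (fun z hz => (hG z (hyY.trans hz.1)).continuousAt.continuousWithinAt)
    (fun z hz => hG z (hyY.trans hz.1.le))
  obtain ⟨ζ, hζ, hζe⟩ := exists_hasDerivAt_eq_slope (deriv φ) (deriv (deriv φ))
    (show ξ < ξ + 1 by linarith)
    (fun z hz => (hdd z (by linarith [hz.1, hξ.1])).continuousAt.continuousWithinAt)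
    (fun z hz => hdd z (by linarith [hz.1, hξ.1]))
  rw [add_sub_cancel_left, div_one] at hξe hζe
  rw [show y + 1 + 1 = y + 2 by ring] at hξe
  have e : φ (y + 2) - φ (y + 1) - (φ (y + 1) - φ y) = deriv (deriv φ) ζ := by
    rw [hζe, hξe]
  rw [e]
  have hb := (hY ζ (by linarith [hζ.1, hξ.1])).2
  have hζ1 : y ≤ ζ := by linarith [hζ.1, hξ.1]
  have hζ2 : ζ ≤ 2 * y := by linarith [hζ.2, hξ.2]
  have b1 := rpow_le_four_mul_rpow (x := y) (y := ζ) (e := 1 / c - 2 - η) (by linarith)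
    (by linarith) (by linarith) (abs_le.2 ⟨by linarith, by linarith⟩)
  have b2 := rpow_le_four_mul_rpow (x := ζ) (y := y) (e := 1 / c - 2 + η) (by linarith)
    (by linarith) (by linarith) (abs_le.2 ⟨by linarith, by linarith⟩)
  exact ⟨by linarith [hb.1], by linarith [hb.2]⟩

lemma eventually_weight_bounds (H : IsPowerLike c x₀ h ϑ) {x₃ : ℝ} {ψ : ℝ → ℝ}
    (hψ : AdmissibleWeight (inverse x₀ h) x₃ ψ) {ε : ℝ} (hε : 0 < ε) :
    ∀ᶠ y in atTop, y ^ (1 / c - 1 - ε) ≤ ψ y ∧ ψ y ≤ y ^ (1 / c - 1 + ε) := by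
  filter_upwards [hψ.2.1.eventually_const_le (show (1 / 2 : ℝ) < 1 by norm_num),
    hψ.2.1.eventually_le_const (show (1 : ℝ) < 2 by norm_num),
    H.eventually_deriv_bounds (half_pos hε), eventually_gt_atTop 0,
    eventually_mul_rpow_le 2 (show 1 / c - 1 - ε < 1 / c - 1 - ε / 2 by linarith),
    eventually_mul_rpow_le 2 (show 1 / c - 1 + ε / 2 < 1 / c - 1 + ε by linarith)]
    with y h1 h2 h3 hy h4 h5
  have hd : 0 < deriv (inverse x₀ h) y := lt_of_lt_of_le (by positivity) h3.1
  rw [le_div_iff₀ hd] at h1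
  rw [div_le_iff₀ hd] at h2
  exact ⟨by linarith [h3.1], by linarith [h3.2]⟩

/-- Since `φ'' < 0` and `ψ' / φ'' → 1`, eventually `deriv ψ < 0`; being nonzero, this value also
certifies differentiability. -/
lemma exists_antitoneOn_weight (H : IsPowerLike c x₀ h ϑ) {x₃ : ℝ} {ψ : ℝ → ℝ}
    (hψ : AdmissibleWeight (inverse x₀ h) x₃ ψ) : ∃ Y, AntitoneOn ψ (Set.Ici Y) := by
  have hev : ∀ᶠ y in atTop, deriv ψ y < 0 := by
    filter_upwards [hψ.2.2.1.eventually_const_lt (show (0 : ℝ) < 1 by norm_num),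
      H.eventually_deriv_deriv_bounds zero_lt_one, eventually_gt_atTop 0] with y h1 h2 hy
    have hd : deriv (deriv (inverse x₀ h)) y < 0 := by
      have : 0 < y ^ (1 / c - 2 - 1) := by positivity
      linarith [h2.1]
    by_contra! hle
    exact absurd h1 (not_lt.2 (div_nonpos_of_nonneg_of_nonpos hle hd.le))
  obtain ⟨Y, hY⟩ := eventually_atTop.1 hev
  have hdiff : ∀ y, Y ≤ y → DifferentiableAt ℝ ψ y := fun y hy =>
    differentiableAt_of_deriv_ne_zero (hY y hy).ne
  exact ⟨Y, antitoneOn_of_deriv_nonpos (convex_Ici Y)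
    (fun y hy => (hdiff y hy).continuousAt.continuousWithinAt)
    (fun y hy => (hdiff y (interior_subset hy)).differentiableWithinAt)
    (fun y hy => (hY y (interior_subset hy)).le)⟩

end IsPowerLike

end RegularVariation

/-! ### `μ_N` and `T_N` as finite sums. -/

section CountingMeasure

variable {B : Set ℕ} {ψ : ℝ → ℝ} {N : ℕ}

/-- The integers `1, …, N`. -/
def intIcc (N : ℕ) : Finset ℤ := (Finset.Icc 1 N).map Nat.castEmbedding

lemma card_intIcc (N : ℕ) : (intIcc N).card = N := by simp [intIcc]

lemma sum_intIcc {M : Type*} [AddCommMonoid M] (F : ℤ → M) :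
    ∑ n ∈ intIcc N, F n = ∑ n ∈ Finset.Ico 1 (N + 1), F (n : ℤ) := by
  rw [intIcc, Finset.sum_map]; rfl

open Classical in
lemma muN_singleton (m : ℤ) :
    muN B ψ N {m} = (N : ℝ≥0∞)⁻¹ * ∑ n ∈ (Finset.Icc 1 N).filter (fun n => n ∈ B),
      if (n : ℤ) = m then ENNReal.ofReal ((ψ (n : ℝ))⁻¹) else 0 := by
  rw [muN, Measure.smul_apply, Measure.finsetSum_apply, smul_eq_mul]
  congr 1
  refine Finset.sum_congr rfl fun n _ => ?_
  rw [Measure.smul_apply, Measure.dirac_apply, smul_eq_mul, Set.indicator_apply]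
  simp

open Classical in
lemma muN_singleton_natCast {n : ℕ} (h1 : 1 ≤ n) (hn : n ≤ N) :
    muN B ψ N {(n : ℤ)}
      = (N : ℝ≥0∞)⁻¹ * if n ∈ B then ENNReal.ofReal ((ψ (n : ℝ))⁻¹) else 0 := by
  rw [muN_singleton]
  congr 1
  simp only [Nat.cast_inj]
  rw [Finset.sum_ite_eq']
  simp [h1, hn]

lemma muN_singleton_eq_zero {m : ℤ} (hm : m ∉ intIcc N) : muN B ψ N {m} = 0 := by
  classical
  rw [muN_singleton, Finset.sum_eq_zero, mul_zero]
  intro n hn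
  rw [if_neg]
  rintro rfl
  exact hm (Finset.mem_map_of_mem _ (Finset.mem_filter.1 hn).1)

lemma muN_singleton_ne_top (hN : 1 ≤ N) (m : ℤ) : muN B ψ N {m} ≠ ∞ := by
  rw [muN_singleton]
  have : (N : ℝ≥0∞) ≠ 0 := by exact_mod_cast (by omega : N ≠ 0)
  refine ENNReal.mul_ne_top (ENNReal.inv_ne_top.2 this) (ENNReal.sum_ne_top.2 fun n _ => ?_)
  split_ifs <;> simp

open Classical in
lemma muN_real_singleton_natCast (hψ : ∀ n ∈ B, 0 < ψ (n : ℝ)) {n : ℕ} (h1 : 1 ≤ n) (hn : n ≤ N) :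
    (muN B ψ N).real {(n : ℤ)} = (N : ℝ)⁻¹ * if n ∈ B then (ψ (n : ℝ))⁻¹ else 0 := by
  rw [measureReal_def, muN_singleton_natCast h1 hn, ENNReal.toReal_mul, ENNReal.toReal_inv,
    ENNReal.toReal_natCast]
  congr 1
  split_ifs with h
  · exact ENNReal.toReal_ofReal (inv_nonneg.2 (hψ n h).le)
  · simp

lemma opT_eq_trigPoly (f : ℤ → ℂ) :
    opT B ψ N f = trigPoly (intIcc N) (fun n => (muN B ψ N).real {n}) f := by
  ext ξ
  rw [opT, fourierZ, trigPoly]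
  refine tsum_eq_sum fun n hn => ?_
  rw [measureReal_def, muN_singleton_eq_zero hn]
  simp

lemma eLpNorm_two_muN (hN : 1 ≤ N) (f : ℤ → ℂ) :
    eLpNorm f 2 (muN B ψ N)
      = ENNReal.ofReal √(∑ n ∈ intIcc N, ‖f n‖ ^ 2 * (muN B ψ N).real {n}) := by
  rw [eLpNorm_eq_lintegral_rpow_enorm_toReal two_ne_zero ENNReal.ofNat_ne_top, lintegral_countable',
    tsum_eq_sum (s := intIcc N) fun n hn => by rw [muN_singleton_eq_zero hn, mul_zero],
    Real.sqrt_eq_rpow, ← ENNReal.ofReal_rpow_of_nonneg _ (by norm_num)]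
  · rw [ENNReal.ofReal_sum_of_nonneg fun n _ => by positivity]
    congr 1
    refine Finset.sum_congr rfl fun n _ => ?_
    rw [ENNReal.ofReal_mul (by positivity), ofReal_measureReal (muN_singleton_ne_top hN n),
      ENNReal.ofReal_pow (norm_nonneg _), ofReal_norm]
    simp
  · exact Finset.sum_nonneg fun n _ => by positivity

end CountingMeasure

/-! ### Closeness of `μ_N` to the uniform measure, and the exponents. -/

section Main

variable {c₁ c₂ x₁ x₂ x₃ : ℝ} {h₁ h₂ ψ ϑ₁ ϑ₂ : ℝ → ℝ}

/-- Bounds for the weights, uniform in the integers at which the weight is defined. -/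
lemma exists_inv_weight_le (H₂ : IsPowerLike c₂ x₂ h₂ ϑ₂)
    (hψ : AdmissibleWeight (inverse x₂ h₂) x₃ ψ) {ε : ℝ} (hε : 0 < ε) :
    ∃ C : ℝ, 1 ≤ C ∧ ∀ N n : ℕ, 1 ≤ n → n ≤ N → x₃ ≤ n →
      (ψ n)⁻¹ ≤ C * (N : ℝ) ^ (1 - 1 / c₂ + ε) := by
  have hc := H₂.one_le
  have hc1 : 1 / c₂ ≤ 1 := by rw [div_le_one (by linarith)]; exact hc
  obtain ⟨N₀, hN₀⟩ := eventually_atTop.1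
    (tendsto_natCast_atTop_atTop.eventually (H₂.eventually_weight_bounds hψ hε))
  -- The sum takes care of the finitely many `n` below the asymptotic range; absolute values are
  -- needed because `ψ` may have any sign outside its domain.
  refine ⟨1 + ∑ n ∈ Finset.range N₀, |(ψ n)⁻¹|, by
    linarith [Finset.sum_nonneg fun n (_ : n ∈ Finset.range N₀) => abs_nonneg (ψ n)⁻¹],
    fun N n hn hnN hx => ?_⟩
  have hM := Finset.sum_nonneg fun n (_ : n ∈ Finset.range N₀) => abs_nonneg (ψ n)⁻¹
  have hn0 : (0 : ℝ) < n := by exact_mod_cast hn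
  have hnN' : (n : ℝ) ≤ N := by exact_mod_cast hnN
  have hN1 : (1 : ℝ) ≤ N := by exact_mod_cast hn.trans hnN
  have hpow : 1 ≤ (N : ℝ) ^ (1 - 1 / c₂ + ε) := Real.one_le_rpow hN1 (by linarith)
  rcases lt_or_ge n N₀ with h | h
  · have h1 : (ψ n)⁻¹ ≤ ∑ n ∈ Finset.range N₀, |(ψ n)⁻¹| :=
      (le_abs_self _).trans (Finset.single_le_sum (f := fun n : ℕ => |(ψ n)⁻¹|)
        (fun _ _ => abs_nonneg _) (Finset.mem_range.2 h))
    nlinarith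
  · have h1 : (ψ n)⁻¹ ≤ (N : ℝ) ^ (1 - 1 / c₂ + ε) := by
      calc (ψ n)⁻¹ ≤ ((n : ℝ) ^ (1 / c₂ - 1 - ε))⁻¹ :=
            inv_anti₀ (by positivity) (hN₀ n h).1
        _ = (n : ℝ) ^ (1 - 1 / c₂ + ε) := by
            rw [← Real.rpow_neg hn0.le]; congr 1; ring
        _ ≤ _ := Real.rpow_le_rpow hn0.le hnN' (by linarith)
    nlinarith

open Classical in
/-- The Fourier transform of the weights on `𝐁` is close to that of the integers. -/
lemma exists_norm_sum_weight_sub_one_le (H₁ : IsPowerLike c₁ x₁ h₁ ϑ₁)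
    (H₂ : IsPowerLike c₂ x₂ h₂ ϑ₂) (hψ : AdmissibleWeight (inverse x₂ h₂) x₃ ψ) (s : ℤˣ)
    {χ ε : ℝ} (hχ : 0 ≤ χ) (hχ1 : χ ≤ 1 / 2) (hε : 0 < ε) (hε1 : ε ≤ 1)
    (hc₁ : 2 * χ + 5 * ε ≤ 2 * (1 / c₂) - 1 - 1 / c₁ / 2)
    (hc₂ : 2 * χ + 5 * ε ≤ 1 / c₁ / 2 + 1 / c₂ - 1) :
    ∃ C : ℝ, 0 < C ∧ ∀ N : ℕ, 1 ≤ N → ∀ ξ : ℝ,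
      ‖∑ n ∈ Finset.Ico 1 (N + 1),
        (((if n ∈ setB s x₁ h₁ x₃ ψ then (ψ n)⁻¹ else 0) - 1 : ℝ) : ℂ) * expi (n * ξ)‖
      ≤ C * (N : ℝ) ^ (1 - χ) := by
  have hc := H₂.one_le
  have hγ₂ : 1 / c₂ ≤ 1 := by rw [div_le_one (by linarith)]; exact hc
  obtain ⟨Y, hY⟩ := H₂.exists_antitoneOn_weight hψ
  obtain ⟨X, hX⟩ := eventually_atTop.1 (((H₁.eventually_second_difference_bounds hε hε1).and
    (H₂.eventually_weight_bounds hψ hε)).and ((eventually_ge_atTop Y).and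
    ((eventually_ge_atTop x₃).and (eventually_ge_atTop (h₁ x₁)))))
  set N₀ := ⌈X⌉₊ with hN₀
  have hXn : ∀ n : ℕ, N₀ ≤ n → X ≤ n := fun n hn =>
    (Nat.le_ceil X).trans (by exact_mod_cast hn)
  set t : ℕ → ℝ := fun n => ((s : ℤ) : ℝ) * inverse x₁ h₁ n with ht
  have hs : ((s : ℤ) : ℝ) = 1 ∨ ((s : ℤ) : ℝ) = -1 := by
    rcases Int.units_eq_one_or s with rfl | rfl <;> simp
  have hdiff : ∀ n : ℕ, -((s : ℤ) : ℝ) * ((t (n + 2) - t (n + 1)) - (t (n + 1) - t n))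
      = -((inverse x₁ h₁ (n + 2) - inverse x₁ h₁ (n + 1))
        - (inverse x₁ h₁ (n + 1) - inverse x₁ h₁ n)) := by
    intro n
    simp only [ht]
    push_cast
    rcases hs with h | h <;> rw [h] <;> ring
  -- The inverse function has negative second differences, so `-s` is the sign that makes those of
  -- `s φ₁` positive.
  obtain ⟨C, hC, hdy⟩ := exists_norm_sum_dyadic_le (t := t) (v := fun n => ψ n) (g₁ := 1 / c₁)
    (g₂ := 1 / c₂) (χ := χ) (ε := ε) (σ := -((s : ℤ) : ℝ)) (N₀ := N₀)
    (by rcases hs with h | h <;> rw [h] <;> norm_num) hγ₂ hχ hε hc₁ hc₂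
    (fun n hn => by rw [hdiff]; exact (hX n (hXn n hn)).1.1.1)
    (fun n hn => by rw [hdiff]; exact (hX n (hXn n hn)).1.1.2)
    (fun m n hm hmn => hY (hX m (hXn m hm)).2.1 (hX n (hXn n (hm.trans hmn))).2.1
      (by exact_mod_cast hmn))
    (fun n hn => by
      have := hψ.1 n (hX n (hXn n hn)).2.2.1
      exact ⟨this.1, by linarith [this.2]⟩)
    (fun n hn => (hX n (hXn n hn)).1.2.1)
    (fun n hn => (hX n (hXn n hn)).1.2.2)
  refine exists_norm_sum_le_of_dyadic (N₀ := 2 * N₀ + 2) hχ1 hC fun N hN ξ => ?_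
  refine le_of_eq_of_le ?_ (hdy N hN ξ)
  congr 1
  refine Finset.sum_congr rfl fun n hn => ?_
  rw [Finset.mem_Ico] at hn
  have hn' := hX n (hXn n (by omega))
  -- For `n` this large the domain conditions in `setB` hold automatically.
  have : n ∈ setB s x₁ h₁ x₃ ψ ↔ Int.fract (t n) < ψ n :=
    ⟨fun h => h.2.2.2, fun h => ⟨by omega, hn'.2.2.2, hn'.2.2.1, h⟩⟩
  simp only [this]

/-- The choice of exponents. -/
lemma exists_exponents {g₁ g₂ p : ℝ} (hg₁ : 1 / 2 < g₁) (hg₁' : g₁ ≤ 1) (hg₂ : 5 / 6 < g₂) (hg₂' : g₂ ≤ 1)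
    (hp₂ : 2 < p) (hp : 2 + (12 - 12 * g₂) / (g₁ + 3 * g₂ - 3) ≤ p) :
    ∃ χ ε ε' q : ℝ, 0 ≤ χ ∧ 0 < ε ∧ ε ≤ 1 ∧ 0 < ε' ∧ 2 < q ∧ q < p ∧
      2 * χ + 5 * ε ≤ 2 * g₂ - 1 - g₁ / 2 ∧ 2 * χ + 5 * ε ≤ g₁ / 2 + g₂ - 1 ∧
      2 * (1 - g₂ + ε') ≤ χ * (q - 2) := by
  -- With this `χ₀` the lower bound for `p` reads `2 (1 - g₂) ≤ χ₀ (p - 2)`.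
  set χ₀ := (g₁ + 3 * g₂ - 3) / 6 with hχ₀
  have hχ₀0 : 0 < χ₀ := by rw [hχ₀]; linarith
  -- With `χ = χ₀ + ε` each constraint needs `7ε` of room beyond `2χ₀`. The room is `g₂ - 5g₁/6` in
  -- the first, positive since `g₂ > 5/6` and `g₁ ≤ 1`, and `g₁/6 > 1/12` in the second.
  set ε := min (1 / 100) ((g₂ - 5 * g₁ / 6) / 7) with hε
  have hε0 : 0 < ε := by
    have : 0 < (g₂ - 5 * g₁ / 6) / 7 := by linarith
    positivity
  have hε1 : ε ≤ 1 / 100 := min_le_left _ _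
  have hε2 : ε ≤ (g₂ - 5 * g₁ / 6) / 7 := min_le_right _ _
  have hmain : 2 * (1 - g₂) ≤ χ₀ * (p - 2) := by
    have h1 : (12 - 12 * g₂) / (g₁ + 3 * g₂ - 3) ≤ p - 2 := by linarith
    rw [div_le_iff₀ (by linarith)] at h1
    rw [hχ₀]; linarith
  have hc₂ : 2 * (χ₀ + ε) + 5 * ε ≤ g₁ / 2 + g₂ - 1 := by rw [hχ₀]; linarith
  -- Raising `χ₀` to `χ₀ + ε` gains `ε (p - 2)`; as `χ₀ + ε ≤ 1`, lowering `p` to `q` uses at most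
  -- half of this, and `2ε'` is the other half.
  refine ⟨χ₀ + ε, ε, ε * (p - 2) / 4, p - ε * (p - 2) / 2, by linarith, hε0, by linarith,
    ?_, ?_, ?_, ?_, hc₂, ?_⟩
  · have : 0 < p - 2 := by linarith
    positivity
  · nlinarith
  · nlinarith
  · rw [hχ₀]; linarith
  · have h1 : 0 < ε * (p - 2) := mul_pos hε0 (by linarith)
    have h2 : χ₀ + ε ≤ 1 := by linarith
    nlinarith

end Main

end Majorant

open Majorant in
theorem proposition2
    (c₁ c₂ : ℝ) (hc₁ : c₁ ∈ Set.Ico (1 : ℝ) 2) (hc₂ : c₂ ∈ Set.Ico (1 : ℝ) (6 / 5))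
    (x₁ x₂ x₃ : ℝ) (h₁ h₂ ψ : ℝ → ℝ)
    (hh₁ : Majorant.ClassR c₁ x₁ h₁) (hh₂ : Majorant.ClassR c₂ x₂ h₂)
    (hψ : Majorant.AdmissibleWeight (Majorant.inverse x₂ h₂) x₃ ψ)
    (s : ℤˣ) (p : ℝ) (hp₂ : 2 < p)
    (hp : 2 + (12 - 12 / c₂) / (1 / c₁ + 3 / c₂ - 3) ≤ p) :
    ∃ C : ℝ, 0 < C ∧ ∀ N : ℕ, 1 ≤ N → ∀ f : ℤ → ℂ,
      eLpNorm (Majorant.opT (Majorant.setB s x₁ h₁ x₃ ψ) ψ N f) (ENNReal.ofReal p) volume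
        ≤ ENNReal.ofReal (C * (N : ℝ) ^ (-1 / p)) *
          eLpNorm f 2 (Majorant.muN (Majorant.setB s x₁ h₁ x₃ ψ) ψ N) := by
  classical
  obtain ⟨ϑ₁, H₁⟩ := hh₁.exists_isPowerLike hc₁.1
  obtain ⟨ϑ₂, H₂⟩ := hh₂.exists_isPowerLike hc₂.1
  have hc₁0 : 0 < c₁ := by linarith [hc₁.1]
  have hc₂0 : 0 < c₂ := by linarith [hc₂.1]
  have hg₁ : 1 / 2 < 1 / c₁ := one_div_lt_one_div_of_lt hc₁0 hc₁.2
  have hg₁' : 1 / c₁ ≤ 1 := by rw [div_le_one hc₁0]; exact hc₁.1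
  have hg₂ : 5 / 6 < 1 / c₂ := by
    have := one_div_lt_one_div_of_lt hc₂0 hc₂.2
    norm_num at this ⊢; exact this
  have hg₂' : 1 / c₂ ≤ 1 := by rw [div_le_one hc₂0]; exact hc₂.1
  obtain ⟨χ, ε, ε', q, hχ, hε, hε1, hε', hq, hqp, hcond₁, hcond₂, hcond₃⟩ :=
    exists_exponents hg₁ hg₁' hg₂ hg₂' hp₂ (by
      rw [show 12 * (1 / c₂) = 12 / c₂ by ring, show 3 * (1 / c₂) = 3 / c₂ by ring]; exact hp)
  obtain ⟨C₁, hC₁, hinv⟩ := exists_inv_weight_le H₂ hψ hε'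
  obtain ⟨C₂, hC₂, hker⟩ := exists_norm_sum_weight_sub_one_le H₁ H₂ hψ s hχ (by linarith) hε hε1
    hcond₁ hcond₂
  set B := setB s x₁ h₁ x₃ ψ with hB
  have hψB : ∀ n ∈ B, 0 < ψ (n : ℝ) := fun n hn => (hψ.1 n hn.2.2.1).1
  have hq0 : 0 < q := by linarith
  have hpq : 0 < p - q := by linarith
  have hp0 : 0 < p := by linarith
  -- The first summand gives `E ≤ K`, the second the condition on `D ^ (2/q) * E ^ (1 - 2/q)`.
  set K := C₂ + C₁ ^ (2 / q) * C₂ ^ (1 - 2 / q) with hK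
  have hK0 : 0 < C₁ ^ (2 / q) * C₂ ^ (1 - 2 / q) := by positivity
  refine ⟨(p / (p - q)) ^ (1 / p) * √(1 + K), by positivity, fun N hN f => ?_⟩
  have hN1 : (1 : ℝ) ≤ N := by exact_mod_cast hN
  have hN0 : (0 : ℝ) < N := by linarith
  rw [opT_eq_trigPoly, eLpNorm_two_muN hN]
  have hw : ∀ n : ℕ, 1 ≤ n → n ≤ N → (muN B ψ N).real {(n : ℤ)}
      = (N : ℝ)⁻¹ * if n ∈ B then (ψ (n : ℝ))⁻¹ else 0 :=
    fun n h1 hn => muN_real_singleton_natCast hψB h1 hn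
  refine eLpNorm_trigPoly_le (N := N) (D := C₁ * (N : ℝ) ^ (-(1 / c₂) + ε'))
    (E := C₂ * (N : ℝ) ^ (-χ)) (K := K) hq hqp hN (card_intIcc N) (fun _ _ => measureReal_nonneg)
    (by positivity) ?_ ?_ ?_ ?_
  · intro m hm
    obtain ⟨n, hn, rfl⟩ := Finset.mem_map.1 hm
    rw [Finset.mem_Icc] at hn
    rw [Nat.castEmbedding_apply, hw n hn.1 hn.2]
    have hpow : (N : ℝ)⁻¹ * (C₁ * (N : ℝ) ^ (1 - 1 / c₂ + ε')) = C₁ * (N : ℝ) ^ (-(1 / c₂) + ε') := by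
      rw [show 1 - 1 / c₂ + ε' = 1 + (-(1 / c₂) + ε') by ring, Real.rpow_add hN0, Real.rpow_one]
      field_simp
    have hone : 1 ≤ C₁ * (N : ℝ) ^ (1 - 1 / c₂ + ε') := by
      have := Real.one_le_rpow hN1 (show 0 ≤ 1 - 1 / c₂ + ε' by linarith)
      nlinarith
    have hle : (if n ∈ B then (ψ (n : ℝ))⁻¹ else 0) ≤ C₁ * (N : ℝ) ^ (1 - 1 / c₂ + ε') := by
      split_ifs with h
      · exact hinv N n hn.1 hn.2 h.2.2.1
      · linarith
    have hge : 0 ≤ (if n ∈ B then (ψ (n : ℝ))⁻¹ else 0) := by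
      split_ifs with h
      · exact (inv_pos.2 (hψB n h)).le
      · exact le_rfl
    rw [← hpow, ← mul_sub_one, abs_mul, abs_of_pos (inv_pos.2 hN0)]
    refine mul_le_mul_of_nonneg_left ?_ (inv_pos.2 hN0).le
    rw [abs_le]
    constructor <;> linarith
  · intro ξ
    induction ξ using QuotientAddGroup.induction_on with
    | H x =>
    have e : ∑ n ∈ intIcc N, (((muN B ψ N).real {n} - (N : ℝ)⁻¹ : ℝ) : ℂ)
          * fourier n (x : UnitAddCircle)
        = ((N : ℝ)⁻¹ : ℝ) * ∑ n ∈ Finset.Ico 1 (N + 1),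
          (((if n ∈ B then (ψ n)⁻¹ else 0) - 1 : ℝ) : ℂ) * expi (n * x) := by
      rw [sum_intIcc, Finset.mul_sum]
      refine Finset.sum_congr rfl fun n hn => ?_
      rw [Finset.mem_Ico] at hn
      rw [hw n hn.1 (by omega), fourier_coe_eq_expi, ← mul_sub_one, Complex.ofReal_mul, mul_assoc,
        Int.cast_natCast]
    refine (congrArg norm e).trans_le ?_
    rw [norm_mul, Complex.norm_real, Real.norm_eq_abs, abs_of_pos (inv_pos.2 hN0),
      inv_mul_le_iff₀ hN0]
    refine (hker N hN x).trans (le_of_eq ?_)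
    rw [show 1 - χ = 1 + -χ by ring, Real.rpow_add hN0, Real.rpow_one]
    ring
  · have : (N : ℝ) ^ (-χ) ≤ 1 := Real.rpow_le_one_of_one_le_of_nonpos hN1 (by linarith)
    nlinarith
  · rw [Real.mul_rpow (by positivity) (by positivity), Real.mul_rpow (by positivity) (by positivity),
      ← Real.rpow_mul hN0.le, ← Real.rpow_mul hN0.le]
    -- After multiplication by `q` this is the last condition on the exponents, `2 (1 - 1/c₂ + ε') ≤
    -- χ (q - 2)`.
    have hexp : (-(1 / c₂) + ε') * (2 / q) + -χ * (1 - 2 / q) ≤ -(2 / q) := by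
      have h1 : (-(1 / c₂) + ε') * (2 / q) + -χ * (1 - 2 / q) + 2 / q
          = (2 * (1 - 1 / c₂ + ε') - χ * (q - 2)) / q := by field_simp; ring
      have h2 : (2 * (1 - 1 / c₂ + ε') - χ * (q - 2)) / q ≤ 0 :=
        div_nonpos_of_nonpos_of_nonneg (by linarith) hq0.le
      linarith
    calc _ = C₁ ^ (2 / q) * C₂ ^ (1 - 2 / q)
            * ((N : ℝ) ^ ((-(1 / c₂) + ε') * (2 / q)) * (N : ℝ) ^ (-χ * (1 - 2 / q))) := by ring
      _ = C₁ ^ (2 / q) * C₂ ^ (1 - 2 / q)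
            * (N : ℝ) ^ ((-(1 / c₂) + ε') * (2 / q) + -χ * (1 - 2 / q)) := by
          rw [← Real.rpow_add hN0]
      _ ≤ K * (N : ℝ) ^ (-(2 / q)) := by
          gcongr
          linarith
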